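/- A multipass pairing heap (eager version) stores its items in a single heap-ordered rooted tree with one item per node (the empty tree if the heap is empty), in which the children of each node form an ordered list. Linking two roots compares their keys and makes the root of larger key the new leftmost child of the other one; ties are broken arbitrarily. The operations are: make-heap creates an empty tree; find-min returns the root; insert links a new one-node tree with the tree of the heap, and meld links the trees of two heaps (no link is done if one of the two trees is empty); decrease-key replaces the key of a given item by a key that is not larger and, if the item is not at the root, cuts its node, together with its subtree, from its parent and links it with the root; delete-min removes the root, makes the ordered list of its children a list of roots, and, as long as this list has at least two roots, does a pairing pass, which links the first root with the second, the third with the fourth, and so on, each winner taking the place of its pair (with an odd number of roots the last one is not linked); delete of an item is a decrease-key of this item to a dummy key $-\infty$, smaller than all keys, followed by a delete-min. Time is the number of elementary steps, where each key comparison, attachment of a root as a child, cut, key change, removal of a root, move past an unpaired root, and start of an operation or of a pairing pass is a step; in particular a link and a cut each take $\mathrm{O}(1)$ time. Let $\lg x=\max\{\log_2 x,0\}$. Given a finite sequence of operations that starts with no heaps, call an item in a heap temporary if it is deleted later in the sequence (possibly by the operation about to be done), and for each operation on a heap let $n$ be the number of temporary items in this heap just before the operation, or $8$ if this number is smaller than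 $8$. Theorem. In any sequence of multipass pairing heap operations starting with no heaps, decrease-key takes $\mathrm{O}(\lg\lg n\cdot\lg\lg\lg n)$ amortized time, delete-min and delete take $\mathrm{O}(\lg n)$ amortized time, and each other operation (make-heap, find-min, insert, meld) takes $\mathrm{O}(1)$ amortized time. That is, there is a constant $C$, independent of the items, the keys, the tie-breaking and the sequence, such that the total time of the sequence is at most $C$ times the sum of $\lg\lg n\cdot\lg\lg\lg n$ over all decrease-keys, $\lg n$ over all delete-mins and deletes, and $1$ over all other operations. Moreover, each make-heap, find-min, insert and meld takes $\mathrm{O}(1)$ time in the worst case. -/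

import Mathlib

namespace MultipassHeap

/-! ### Heap-ordered trees and the two elementary operations on them -/

/-- An ordered list of rooted ordered trees whose nodes carry an item and a key, listed from left
to right. `cons e k c r` is the list whose leftmost tree has a root with item `e`, key `k` and
list of children `c`, and whose other trees form the list `r`. -/
inductive Forest (α κ : Type*) where
  | nil : Forest α κ
  | cons (item : α) (key : κ) (children : Forest α κ) (rest : Forest α κ) : Forest α κ

namespace Forest

/-- The single tree whose root has item `e`, key `k` and list of children `c`.
A heap is either `nil` (the empty heap) or of this form. -/
abbrev tree {α κ : Type*} (e : α) (k : κ) (c : Forest α κ) : Forest α κ := cons e k c nil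

/-- All items of a forest. -/
def items {α κ : Type*} : Forest α κ → List α
  | nil => []
  | cons e _ c r => e :: (items c ++ items r)

/-- The item at the leftmost root, if there is one. -/
def root? {α κ : Type*} : Forest α κ → Option α
  | nil => none
  | cons e _ _ _ => some e

end Forest

open Forest

/-- `Link t u w`: linking the roots of the trees `t` and `u` can produce the tree `w`. The root of
smaller key becomes the parent of the other one, which becomes its new leftmost child. If the keys
are equal, either root may win. -/
inductive Link {α κ : Type*} [LinearOrder κ] : Forest α κ → Forest α κ → Forest α κ → Prop
  | left_wins (e f : α) (k l : κ) (c d : Forest α κ) (h : k ≤ l) :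
      Link (tree e k c) (tree f l d) (tree e k (cons f l d c))
  | right_wins (e f : α) (k l : κ) (c d : Forest α κ) (h : l ≤ k) :
      Link (tree e k c) (tree f l d) (tree f l (cons e k c d))

/-- `Cut e F k d F'`: the forest `F` contains a node with item `e`, key `k` and list of children
`d`, and `F'` is what remains of `F` once this node and all its descendants are detached. -/
inductive Cut {α κ : Type*} (e : α) : Forest α κ → κ → Forest α κ → Forest α κ → Prop
  | here (k : κ) (d r : Forest α κ) : Cut e (cons e k d r) k d r
  | inside (f : α) (l : κ) (c c' r : Forest α κ) (k : κ) (d : Forest α κ) (h : Cut e c k d c') :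
      Cut e (cons f l c r) k d (cons f l c' r)
  | later (f : α) (l : κ) (c r r' : Forest α κ) (k : κ) (d : Forest α κ) (h : Cut e r k d r') :
      Cut e (cons f l c r) k d (cons f l c r')

/-! ### Operations on single heaps, with the number of elementary steps they take

The elementary steps, each counted as one unit of time, are: entering an operation or a pairing
pass (this includes the test whether a root list has no, one or several roots), comparing two keys,
making a root the leftmost child of another one, cutting a node from its parent, changing a key,
removing the root of a tree, and moving past a root that stays unpaired. So a link takes two
steps, a comparison and an attachment. -/

/-- `Join F G H t`: combining the heaps `F` and `G` gives `H` in `t` steps. If one of them is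
empty, the result is the other one. Otherwise their roots are linked. -/
inductive Join {α κ : Type*} [LinearOrder κ] :
    Forest α κ → Forest α κ → Forest α κ → ℕ → Prop
  | nil_left (G : Forest α κ) : Join nil G G 0
  | nil_right (F : Forest α κ) : Join F nil F 0
  | link (F G H : Forest α κ) (h : Link F G H) : Join F G H 2

/-- `PairingPass F G t`: a pairing pass turns the root list `F` into the root list `G` in `t` steps.
The first root is linked with the second, the third with the fourth, and so on; the winner of each
link takes the place of the pair; if the number of roots is odd, the rightmost is not linked. -/
inductive PairingPass {α κ : Type*} [LinearOrder κ] : Forest α κ → Forest α κ → ℕ → Prop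
  | nil : PairingPass nil nil 0
  | single (e : α) (k : κ) (c : Forest α κ) : PairingPass (tree e k c) (tree e k c) 1
  | pair (e f g : α) (k l m : κ) (c d b r r' : Forest α κ) (t : ℕ)
      (hlink : Link (tree e k c) (tree f l d) (tree g m b)) (hrest : PairingPass r r' t) :
      PairingPass (cons e k c (cons f l d r)) (cons g m b r') (t + 2)

/-- `Multipass F G t`: repeated pairing passes, performed while the root list has at least two
roots, turn the root list `F` into the heap `G` in `t` steps. -/
inductive Multipass {α κ : Type*} [LinearOrder κ] : Forest α κ → Forest α κ → ℕ → Prop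
  | nil : Multipass nil nil 1
  | single (e : α) (k : κ) (c : Forest α κ) : Multipass (tree e k c) (tree e k c) 1
  | pass (e f : α) (k l : κ) (c d r F G : Forest α κ) (s t : ℕ)
      (hpass : PairingPass (cons e k c (cons f l d r)) F s) (hrest : Multipass F G t) :
      Multipass (cons e k c (cons f l d r)) G (s + t + 1)

/-- `DeleteMin F G t`: delete-min turns the nonempty heap `F` into `G` in `t` steps. The root is
removed, and its children are combined by repeated pairing passes. -/
inductive DeleteMin {α κ : Type*} [LinearOrder κ] : Forest α κ → Forest α κ → ℕ → Prop
  | mk (e : α) (k : κ) (c G : Forest α κ) (t : ℕ) (h : Multipass c G t) :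
      DeleteMin (tree e k c) G (t + 2)

/-- `DecreaseKey e k' F G t`: changing the key of the item `e` of the heap `F` to `k'`, which must
not be larger than its old key, gives `G` in `t` steps. If `e` is not at the root, it is
cut from its parent and linked with the root. -/
inductive DecreaseKey {α κ : Type*} [LinearOrder κ] (e : α) (k' : κ) :
    Forest α κ → Forest α κ → ℕ → Prop
  | root (k : κ) (c : Forest α κ) (hk : k' ≤ k) : DecreaseKey e k' (tree e k c) (tree e k' c) 2
  | nonroot (f : α) (l : κ) (c c' : Forest α κ) (k : κ) (d G : Forest α κ)
      (hcut : Cut e c k d c') (hk : k' ≤ k) (hlink : Link (tree e k' d) (tree f l c') G) :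
      DecreaseKey e k' (tree f l c) G 5

/-! ### Sequences of operations on a collection of heaps -/

/-- The operations on a collection of heaps that are named by natural numbers. Items are elements
of `α`, keys are elements of `K`. The result returned by a find-min is part of the data. -/
inductive Op (α K : Type*) where
  | makeHeap (h : ℕ) : Op α K
  | findMin (h : ℕ) (result : Option α) : Op α K
  | insert (h : ℕ) (e : α) (k : K) : Op α K
  | meld (h₁ h₂ : ℕ) : Op α K
  | decreaseKey (h : ℕ) (e : α) (k : K) : Op α K
  | deleteMin (h : ℕ) : Op α K
  | delete (h : ℕ) (e : α) : Op α K

/-- A collection of heaps: `σ h` is the heap with name `h`, or `none` if there is no such heap.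
The bottom element of `WithBot K` is the dummy key used by deletions of arbitrary items. -/
abbrev State (α K : Type*) := ℕ → Option (Forest α (WithBot K))

/-- The item `e` is in one of the heaps of the collection `σ`. -/
def Present {α K : Type*} (σ : State α K) (e : α) : Prop :=
  ∃ h F, σ h = some F ∧ e ∈ F.items

/-- `Step σ o σ' t`: performing the operation `o` on the collection `σ` of heaps is allowed, can
result in the collection `σ'`, and then takes `t` elementary steps. The heap resulting from
`meld h₁ h₂` has the name `h₁`, and the name `h₂` becomes unused. -/
inductive Step {α K : Type*} [LinearOrder K] (σ : State α K) :
    Op α K → State α K → ℕ → Prop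
  | makeHeap (h : ℕ) (hh : σ h = none) :
      Step σ (.makeHeap h) (Function.update σ h (some nil)) 1
  | findMin (h : ℕ) (F : Forest α (WithBot K)) (hF : σ h = some F) :
      Step σ (.findMin h F.root?) σ 1
  | insert (h : ℕ) (e : α) (k : K) (F G : Forest α (WithBot K)) (t : ℕ) (hF : σ h = some F)
      (he : ¬ Present σ e) (hG : Join (tree e (k : WithBot K) nil) F G t) :
      Step σ (.insert h e k) (Function.update σ h (some G)) (t + 1)
  | meld (h₁ h₂ : ℕ) (F₁ F₂ G : Forest α (WithBot K)) (t : ℕ) (hne : h₁ ≠ h₂)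
      (hF₁ : σ h₁ = some F₁) (hF₂ : σ h₂ = some F₂) (hG : Join F₁ F₂ G t) :
      Step σ (.meld h₁ h₂) (Function.update (Function.update σ h₂ none) h₁ (some G)) (t + 1)
  | decreaseKey (h : ℕ) (e : α) (k : K) (F G : Forest α (WithBot K)) (t : ℕ)
      (hF : σ h = some F) (hG : DecreaseKey e (k : WithBot K) F G t) :
      Step σ (.decreaseKey h e k) (Function.update σ h (some G)) t
  | deleteMin (h : ℕ) (F G : Forest α (WithBot K)) (t : ℕ)
      (hF : σ h = some F) (hG : DeleteMin F G t) :
      Step σ (.deleteMin h) (Function.update σ h (some G)) t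
  | delete (h : ℕ) (e : α) (F F' G : Forest α (WithBot K)) (s t : ℕ) (hF : σ h = some F)
      (hF' : DecreaseKey e ⊥ F F' s) (hG : DeleteMin F' G t) :
      Step σ (.delete h e) (Function.update σ h (some G)) (s + t)

/-- `op 0, …, op (m - 1)` is a sequence of operations starting with no heaps, `σ i` is the collection
of heaps just before the operation `op i`, and this operation takes `time i` elementary steps. -/
structure IsExecution {α K : Type*} [LinearOrder K] (m : ℕ) (op : ℕ → Op α K)
    (σ : ℕ → State α K) (time : ℕ → ℕ) : Prop where
  start : σ 0 = fun _ => none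
  step : ∀ i < m, Step (σ i) (op i) (σ (i + 1)) (time i)

/-- The number of temporary items in the heap `h` just before the operation with index `i` in
a sequence of `m` operations. An item is temporary if it is deleted by this or a later operation
of the sequence, which is the case exactly if it is absent at some later time. -/
noncomputable def numTemporary {α K : Type*} (m : ℕ) (σ : ℕ → State α K) (i h : ℕ) : ℕ :=
  {e : α | (∃ F, σ i h = some F ∧ e ∈ F.items) ∧ ∃ j, i < j ∧ j ≤ m ∧ ¬ Present (σ j) e}.ncard

/-! ### The time bounds -/

/-- The binary logarithm, replaced by `0` where it is negative. -/
noncomputable def lg (x : ℝ) : ℝ := max (Real.logb 2 x) 0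

/-- The amortized time bounds, up to a constant factor. Here `count h` is the number of temporary
items in heap `h`, and numbers below `8` are replaced by `8`. -/
noncomputable def amortizedBound {α K : Type*} (count : ℕ → ℕ) : Op α K → ℝ
  | .makeHeap _ => 1
  | .findMin _ _ => 1
  | .insert _ _ _ => 1
  | .meld _ _ => 1
  | .decreaseKey h _ _ => lg (lg (max (count h) 8 : ℕ)) * lg (lg (lg (max (count h) 8 : ℕ)))
  | .deleteMin h => lg (max (count h) 8 : ℕ)
  | .delete h _ => lg (max (count h) 8 : ℕ)

/-- The operations other than decrease-key, delete-min and delete. -/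
def Op.IsConstantTime {α K : Type*} : Op α K → Prop
  | .makeHeap _ => True
  | .findMin _ _ => True
  | .insert _ _ _ => True
  | .meld _ _ => True
  | .decreaseKey _ _ _ => False
  | .deleteMin _ => False
  | .delete _ _ => False

end MultipassHeap

namespace MultipassHeap

/-! ### The level functions -/

/-! The proof is a potential argument in which the potential knows the future. A child is real if it
and its parent are temporary and its node is next cut by the deletion of that parent; the function
`fl` holds this prediction and the mark `planned` records it. Only real children count in sizes. A
decrease-key cuts only unplanned nodes, so its cut changes no size, level or variation
(`Cut.exists_outcome`). With s the size of a node and R the total size on its right, its level is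
essentially log log((s+R)/s).

A temporary root pays for the gauge of its level, minus a multiple of its base level, plus the
variation of the gauged base levels of its real children. When a root loses a real link, its base
becomes the level of the winner, capped by the loser's own new level. By `logLevel_trichotomy` the
loser is well above the winner, or descends by a constant, or is low. In each case `rootTerm_link`
gains a constant if the loser has won before in the same deletion. A descent is paid by the gauge,
and a low root carries an extra charge, affordable because a list has only O(log n) low roots
(`low_add_lowBound_le`). In the remaining case an earlier winner cashes in a surplus, up to 1/2, of
its level over its base. That surplus was funded when it won, because the base of the loser was then
raised to about the winner's level. All this needs the base levels of the two roots to be close;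
their difference is charged to the variation along the root list.

The gauge is a sum of ramps with thresholds growing like (3/2)^j. Pass j gives up ramp j, which
turns gauged variation into plain differences at the price of one threshold per link
(`abs_sub_le_threshold_add`). As the number of roots halves in each pass, these prices sum to a
small multiple of the number of children. Only O(log x) ramps are active at x, so the gauge is O(x
log x) for large x. At x of order log log n, this is the cost of creating a real link in a
decrease-key (`decreaseKey_cost_le`).

If the left root wins, the level of the loser may rise. The rise of its gauge is at most a constant
times the square root of a difference of logarithms (`gauge_level_le_of_left_wins`). By
`mul_sqrt_le`, this costs a small multiple of the pass weight plus a share of a telescoping sum.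
Over all passes the telescoping sums contribute O(log n).

Links without an earlier winner as loser are controlled over three consecutive passes
(`PassOutcome.passGain_le`). The gain is proportional to the number of children of the deleted root
and pays for the deletion.

For meld and insert, subtracting a multiple of log(k!), with k the number of temporary items of the
heap, absorbs the O(log k) energy of a link of two temporary roots. A deletion lowers k by one and
repays O(log k). No item is temporary at the end, where the potential is therefore nonnegative; it
is zero at the start.

Predictions are built backwards in time and marks forwards; this is the quantifier pattern of
`Step.exists_outcome` and `IsExecution.sum_time_le_potential`. -/

/-- The weight of the pairing pass with index `j`. -/
noncomputable def passWeight (j : ℕ) : ℝ := (3 / 2) ^ j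

/-- The threshold of the pairing pass with index `j`. -/
noncomputable def threshold (j : ℕ) : ℝ := (passWeight j - 1) / 4000

/-- A piecewise linear function that grows slightly faster than linearly. -/
noncomputable def gauge (N j : ℕ) (x : ℝ) : ℝ := ∑ i ∈ Finset.Ico j N, max (x - threshold i) 0

lemma one_le_passWeight (j : ℕ) : 1 ≤ passWeight j := one_le_pow₀ (by norm_num)

lemma passWeight_pos (j : ℕ) : 0 < passWeight j := lt_of_lt_of_le one_pos (one_le_passWeight j)

lemma passWeight_succ (j : ℕ) : passWeight (j + 1) = passWeight j * (3 / 2) := pow_succ _ _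

@[simp] lemma passWeight_zero : passWeight 0 = 1 := pow_zero _

lemma threshold_nonneg (j : ℕ) : 0 ≤ threshold j :=
  div_nonneg (sub_nonneg.2 (one_le_passWeight j)) (by norm_num)

lemma gauge_eq_add {N j : ℕ} (h : j < N) (x : ℝ) :
    gauge N j x = max (x - threshold j) 0 + gauge N (j + 1) x :=
  Finset.sum_eq_sum_Ico_succ_bot h _

lemma gauge_mono (N j : ℕ) {x y : ℝ} (h : x ≤ y) : gauge N j x ≤ gauge N j y :=
  Finset.sum_le_sum fun _ _ => max_le_max (by linarith) le_rfl

@[simp] lemma gauge_zero (N j : ℕ) : gauge N j 0 = 0 :=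
  Finset.sum_eq_zero fun i _ => max_eq_right (by linarith [threshold_nonneg i])

lemma gauge_nonneg (N j : ℕ) (x : ℝ) : 0 ≤ gauge N j x :=
  Finset.sum_nonneg fun _ _ => le_max_right _ _

lemma gauge_sub_le_gauge_sub (N j : ℕ) {x y : ℝ} (h : x ≤ y) :
    gauge N j y - gauge N j x ≤ gauge N 0 y - gauge N 0 x := by
  unfold gauge
  rw [← Finset.sum_sub_distrib, ← Finset.sum_sub_distrib]
  refine Finset.sum_le_sum_of_subset_of_nonneg (Finset.Ico_subset_Ico_left (Nat.zero_le j)) ?_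
  intro i _ _
  exact sub_nonneg.2 (max_le_max (by linarith) le_rfl)

/-- The first ramp has threshold 0, hence slope one on the nonnegative reals. A descent of the gauge
therefore also pays for the descent of the level itself. -/
lemma sub_le_gauge_sub {N : ℕ} (hN : 0 < N) {x y : ℝ} (hx : 0 ≤ x) (h : x ≤ y) :
    y - x ≤ gauge N 0 y - gauge N 0 x := by
  have h1 := gauge_eq_add hN x
  have h2 := gauge_eq_add hN y
  have h3 := gauge_mono N (0 + 1) h
  have : threshold 0 = 0 := by simp [threshold]
  rw [this, sub_zero, max_eq_left hx] at h1
  rw [this, sub_zero, max_eq_left (hx.trans h)] at h2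
  linarith

lemma le_gauge {N : ℕ} (hN : 0 < N) {x : ℝ} (hx : 0 ≤ x) : x ≤ gauge N 0 x := by
  have := sub_le_gauge_sub hN le_rfl hx
  simpa using this

lemma abs_gauge_succ_le (N j : ℕ) (x y : ℝ) :
    |gauge N (j + 1) x - gauge N (j + 1) y| ≤ |gauge N j x - gauge N j y| := by
  wlog h : x ≤ y generalizing x y
  · rw [abs_sub_comm, abs_sub_comm (gauge N j x)]
    exact this y x (le_of_not_ge h)
  have h1 := gauge_mono N (j + 1) h
  rw [abs_sub_comm, abs_sub_comm (gauge N j x), abs_of_nonneg (sub_nonneg.2 h1),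
    abs_of_nonneg (sub_nonneg.2 (gauge_mono N j h))]
  rcases lt_or_ge j N with hj | hj
  · rw [gauge_eq_add hj, gauge_eq_add hj]
    have : max (x - threshold j) 0 ≤ max (y - threshold j) 0 := max_le_max (by linarith) le_rfl
    linarith
  · simp [gauge, Finset.Ico_eq_empty_of_le hj, Finset.Ico_eq_empty_of_le (hj.trans (Nat.le_succ j))]

/-- Ramp j has slope one beyond its threshold, so dropping it from the gauge releases the plain
distance up to that threshold. This is the only source of payment for the distance of the base
levels of two linked roots. -/
lemma abs_sub_le_threshold_add {N j : ℕ} (hj : j < N) {x y : ℝ} (hx : 0 ≤ x) (hy : 0 ≤ y) :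
    |x - y| + |gauge N (j + 1) x - gauge N (j + 1) y| ≤
      threshold j + |gauge N j x - gauge N j y| := by
  wlog h : x ≤ y generalizing x y
  · rw [abs_sub_comm x, abs_sub_comm (gauge N (j + 1) x), abs_sub_comm (gauge N j x)]
    exact this hy hx (le_of_not_ge h)
  rw [abs_sub_comm x, abs_sub_comm (gauge N (j + 1) x), abs_sub_comm (gauge N j x),
    abs_of_nonneg (sub_nonneg.2 h),
    abs_of_nonneg (sub_nonneg.2 (gauge_mono N j h)),
    abs_of_nonneg (sub_nonneg.2 (gauge_mono N (j + 1) h)), gauge_eq_add hj, gauge_eq_add hj]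
  have := threshold_nonneg j
  rcases le_total (x - threshold j) 0 with h1 | h1
  · rw [max_eq_right h1]
    have := le_max_left (y - threshold j) 0
    linarith
  · rw [max_eq_left h1, max_eq_left (by linarith)]
    linarith

/-! ### Levels and the growth of their gauge -/

/-- The level of a node as a function of the logarithm of the ratio of its mass to its size. -/
noncomputable def logLevel (d : ℝ) : ℝ := Real.log (max 1 (d / 4))

/-- The level of a node of size `s` whose siblings on the right have total size `R`. -/
noncomputable def level (s R : ℕ) : ℝ := logLevel (Real.log ((s + R : ℝ) / s))

lemma logLevel_nonneg (d : ℝ) : 0 ≤ logLevel d := Real.log_nonneg (le_max_left _ _)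

lemma logLevel_mono {d e : ℝ} (h : d ≤ e) : logLevel d ≤ logLevel e :=
  Real.log_le_log (lt_of_lt_of_le one_pos (le_max_left _ _)) (max_le_max le_rfl (by linarith))

lemma level_nonneg (s R : ℕ) : 0 ≤ level s R := logLevel_nonneg _

@[simp] lemma logLevel_zero : logLevel 0 = 0 := by simp [logLevel]

lemma level_zero_right {s : ℕ} (hs : 0 < s) : level s 0 = 0 := by
  have : (s : ℝ) ≠ 0 := by positivity
  simp [level, this]

lemma level_le_level {s s' R R' : ℕ} (hs : 0 < s) (hs' : 0 < s')
    (h : (s + R) * s' ≤ (s' + R') * s) : level s R ≤ level s' R' := by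
  have h1 : (0 : ℝ) < s := by exact_mod_cast hs
  have h2 : (0 : ℝ) < s' := by exact_mod_cast hs'
  refine logLevel_mono (Real.log_le_log (by positivity) ?_)
  rw [div_le_div_iff₀ h1 h2]
  exact_mod_cast h

lemma level_mono_right {s R R' : ℕ} (hs : 0 < s) (h : R ≤ R') : level s R ≤ level s R' :=
  level_le_level hs hs (Nat.mul_le_mul_right _ (by omega))

/-- Truncating a logarithm from below amounts to truncating its argument, so a ramp applied to a
level is again a truncated logarithm. -/
lemma max_logLevel_sub {c : ℝ} (hc : 0 ≤ c) (d : ℝ) :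
    max (logLevel d - c) 0 = Real.log (max (4 * Real.exp c) d) - Real.log (4 * Real.exp c) := by
  have h1 : 1 ≤ Real.exp c := Real.one_le_exp hc
  have h4 : Real.log (4 * Real.exp c) = Real.log 4 + c := by
    rw [Real.log_mul (by norm_num) (by positivity), Real.log_exp]
  rcases le_total d (4 * Real.exp c) with h | h
  · rw [max_eq_left h, sub_self]
    refine max_eq_right (sub_nonpos.2 ?_)
    rw [logLevel, Real.log_le_iff_le_exp (lt_of_lt_of_le one_pos (le_max_left _ _))]
    exact max_le h1 (by linarith)
  · have h2 : logLevel d = Real.log d - Real.log 4 := by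
      rw [logLevel, max_eq_right (by linarith), Real.log_div (by linarith) (by norm_num)]
    have h3 : Real.log (4 * Real.exp c) ≤ Real.log d := Real.log_le_log (by positivity) h
    rw [max_eq_right h, h2, max_eq_left (by linarith)]
    linarith

/-- As a function of the square root, the logarithm has derivative 2/√d. The truncation keeps √d at
least 2·exp(c/2), so the slope is at most exp(-c/2). -/
lemma max_logLevel_sub_le {c : ℝ} (hc : 0 ≤ c) {d e : ℝ} (h : d ≤ e) :
    max (logLevel e - c) 0 - max (logLevel d - c) 0 ≤
      Real.exp (-(c / 2)) * (Real.sqrt e - Real.sqrt d) := by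
  rw [max_logLevel_sub hc, max_logLevel_sub hc]
  set q := Real.exp (c / 2) with hq
  have hq0 : 0 < q := Real.exp_pos _
  have hqc : 4 * Real.exp c = (2 * q) ^ 2 := by
    rw [mul_pow, hq, ← Real.exp_nat_mul]
    norm_num
    ring_nf
  rw [hqc]
  set u := max ((2 * q) ^ 2) d
  set v := max ((2 * q) ^ 2) e
  have hu : (2 * q) ^ 2 ≤ u := le_max_left _ _
  have huv : u ≤ v := max_le_max le_rfl h
  have hu0 : 0 < u := lt_of_lt_of_le (by positivity) hu
  have hsu : 2 * q ≤ Real.sqrt u := Real.le_sqrt_of_sq_le hu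
  have hsuv : Real.sqrt u ≤ Real.sqrt v := Real.sqrt_le_sqrt huv
  have hsu0 : 0 < Real.sqrt u := lt_of_lt_of_le (by positivity) hsu
  have hdiff : Real.sqrt v - Real.sqrt u ≤ Real.sqrt e - Real.sqrt d := by
    rcases le_total e ((2 * q) ^ 2) with h1 | h1
    · have : u = v := by simp [u, v, max_eq_left h1, max_eq_left (h.trans h1)]
      rw [this, sub_self]
      exact sub_nonneg.2 (Real.sqrt_le_sqrt h)
    · have h2 : v = e := max_eq_right h1
      have h3 : Real.sqrt d ≤ Real.sqrt u := Real.sqrt_le_sqrt (le_max_right _ _)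
      rw [h2]
      linarith
  have hlog : Real.log v - Real.log u ≤ 2 * (Real.sqrt v / Real.sqrt u - 1) := by
    have h1 := Real.log_le_sub_one_of_pos (div_pos (hsu0.trans_le hsuv) hsu0)
    rw [Real.log_div (hsu0.trans_le hsuv).ne' hsu0.ne', Real.log_sqrt (hu0.le.trans huv),
      Real.log_sqrt hu0.le] at h1
    linarith
  have hbound : 2 * (Real.sqrt v / Real.sqrt u - 1) ≤ q⁻¹ * (Real.sqrt v - Real.sqrt u) := by
    rw [div_sub_one hsu0.ne', ← mul_div_assoc, div_le_iff₀ hsu0]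
    have h1 : 2 ≤ q⁻¹ * Real.sqrt u := by
      rw [inv_mul_eq_div, le_div_iff₀ hq0]
      exact hsu
    nlinarith
  have hfin : q⁻¹ * (Real.sqrt v - Real.sqrt u) ≤ q⁻¹ * (Real.sqrt e - Real.sqrt d) :=
    mul_le_mul_of_nonneg_left hdiff (by positivity)
  rw [Real.exp_neg, ← hq]
  linarith

/-- From exp y ≥ 1 + y each term is at most 8000·(2/3)^i. The bound is uniform in N, so the
truncation index of the gauge never enters the final constants. -/
lemma sum_exp_threshold_le (N : ℕ) :
    ∑ i ∈ Finset.Ico 0 N, Real.exp (-(threshold i / 2)) ≤ 24000 := by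
  have key : ∀ i, Real.exp (-(threshold i / 2)) ≤ 8000 * (2 / 3 : ℝ) ^ i := by
    intro i
    have h1 := Real.add_one_le_exp (threshold i / 2)
    have h2 : passWeight i / 8000 ≤ Real.exp (threshold i / 2) := by
      refine le_trans ?_ h1
      unfold threshold
      linarith
    rw [Real.exp_neg]
    have h3 : 0 < passWeight i / 8000 := div_pos (passWeight_pos i) (by norm_num)
    calc (Real.exp (threshold i / 2))⁻¹ ≤ (passWeight i / 8000)⁻¹ := inv_anti₀ h3 h2
      _ = 8000 * (2 / 3 : ℝ) ^ i := by
        rw [inv_div, passWeight, div_eq_mul_inv, ← inv_pow]; norm_num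
  calc _ ≤ ∑ i ∈ Finset.Ico 0 N, 8000 * (2 / 3 : ℝ) ^ i := Finset.sum_le_sum fun i _ => key i
    _ = 8000 * ∑ i ∈ Finset.range N, (2 / 3 : ℝ) ^ i := by
      rw [← Finset.mul_sum, Nat.Ico_zero_eq_range]
    _ ≤ 8000 * 3 := by
      gcongr
      have h := geom_sum_eq (x := (2 / 3 : ℝ)) (by norm_num) N
      rw [h, div_le_iff_of_neg (by norm_num)]
      have : 0 ≤ (2 / 3 : ℝ) ^ N := by positivity
      linarith
    _ = 24000 := by norm_num

lemma gauge_logLevel_sub_le (N : ℕ) {d e : ℝ} (h : d ≤ e) :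
    gauge N 0 (logLevel e) - gauge N 0 (logLevel d) ≤
      24000 * (Real.sqrt e - Real.sqrt d) := by
  have h1 : 0 ≤ Real.sqrt e - Real.sqrt d := sub_nonneg.2 (Real.sqrt_le_sqrt h)
  unfold gauge
  rw [← Finset.sum_sub_distrib]
  calc _ ≤ ∑ i ∈ Finset.Ico 0 N, Real.exp (-(threshold i / 2)) * (Real.sqrt e - Real.sqrt d) :=
        Finset.sum_le_sum fun i _ => max_logLevel_sub_le (threshold_nonneg i) h
    _ ≤ _ := by
      rw [← Finset.sum_mul]
      exact mul_le_mul_of_nonneg_right (sum_exp_threshold_le N) h1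

lemma gauge_logLevel_add_le (N : ℕ) {d e δ : ℝ} (hd : 0 ≤ d) (hδ : 0 ≤ δ) (h : e ≤ d + δ) :
    gauge N 0 (logLevel e) ≤ gauge N 0 (logLevel d) + 24000 * Real.sqrt δ := by
  have h1 := gauge_logLevel_sub_le N (le_add_of_nonneg_right hδ : d ≤ d + δ)
  have h2 := gauge_mono N 0 (logLevel_mono h)
  have h3 : Real.sqrt (d + δ) ≤ Real.sqrt d + Real.sqrt δ := by
    rw [Real.sqrt_le_left (by positivity)]
    nlinarith [Real.sq_sqrt hd, Real.sq_sqrt hδ, Real.sqrt_nonneg d, Real.sqrt_nonneg δ]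
  linarith

lemma log_cast_nonneg (n : ℕ) : 0 ≤ Real.log n := Real.log_natCast_nonneg n

lemma log_cast_mono {m n : ℕ} (h : m ≤ n) : Real.log m ≤ Real.log n := by
  rcases Nat.eq_zero_or_pos m with rfl | hm
  · simpa using log_cast_nonneg n
  · exact Real.log_le_log (by exact_mod_cast hm) (by exact_mod_cast h)

lemma level_le_logLevel_log {s R n : ℕ} (hs : 0 < s) (h : s + R ≤ n) :
    level s R ≤ logLevel (Real.log n) := by
  have h1 : (1 : ℝ) ≤ s := by exact_mod_cast hs
  have h2 : (s + R : ℝ) ≤ n := by exact_mod_cast h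
  refine logLevel_mono (Real.log_le_log (by positivity) ?_)
  rw [div_le_iff₀ (by linarith)]
  nlinarith

/-- A crude bound for operations that can afford a logarithm: melds and insertions, through the
factorial term, and deletions. -/
lemma gauge_logLevel_log_le (N n : ℕ) :
    gauge N 0 (logLevel (Real.log n)) ≤ 24000 * (1 + Real.log n) := by
  have h0 := log_cast_nonneg n
  have h1 := gauge_logLevel_sub_le N h0
  simp only [logLevel_zero, gauge_zero, Real.sqrt_zero, sub_zero] at h1
  have h2 : Real.sqrt (Real.log n) ≤ 1 + Real.log n := by
    rw [Real.sqrt_le_left (by linarith)]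
    nlinarith
  linarith

/-! ### Levels of two linked roots -/

/-- The winner of a link descends at least to the level of the loser. -/
lemma level_add_le_left (s t R : ℕ) (hs : 0 < s) : level (s + t) R ≤ level s (t + R) :=
  level_le_level (by omega) hs (by nlinarith)

lemma level_add_le_right (s t R : ℕ) (ht : 0 < t) : level (s + t) R ≤ level t R :=
  level_le_level (by omega) ht (by nlinarith)

/-- If the left root wins, the gauge of the level of the loser grows by a bounded amount. -/
lemma gauge_level_le_of_left_wins (N : ℕ) {s t : ℕ} (R : ℕ) (hs : 0 < s) (ht : 0 < t) :
    gauge N 0 (level t (s - 1)) ≤ gauge N 0 (level t R) + 24000 *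
      Real.sqrt (Real.log ((s + t + R : ℕ) : ℝ) - Real.log ((t + R : ℕ) : ℝ)) := by
  have h1 : (1 : ℝ) ≤ t := by exact_mod_cast ht
  have h2 : (1 : ℝ) ≤ s := by exact_mod_cast hs
  have h3 : (0 : ℝ) ≤ R := by positivity
  refine gauge_logLevel_add_le N ?_ ?_ ?_
  · refine Real.log_nonneg ?_
    rw [le_div_iff₀ (by linarith)]
    linarith
  · exact sub_nonneg.2 (log_cast_mono (by omega))
  · rw [Real.log_div (by positivity) (by positivity), Real.log_div (by positivity) (by positivity)]
    -- The `- 1` arises because the right siblings of the new child are the previous children of the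
    -- winner, without the winner itself.
    have : Real.log (t + (s - 1 : ℕ)) ≤ Real.log ((s + t + R : ℕ) : ℝ) := by
      refine Real.log_le_log (by positivity) ?_
      have : t + (s - 1) ≤ s + t + R := by omega
      exact_mod_cast this
    push_cast at this ⊢
    linarith

lemma level_le_of_right_wins {s t : ℕ} (R : ℕ) (hs : 0 < s) : level s (t - 1) ≤ level s (t + R) :=
  level_mono_right hs (by omega)

/-! ### The trichotomy for the loser of a link -/

lemma two_fifths_le_log : (2 / 5 : ℝ) ≤ Real.log (3 / 2) := by
  rw [Real.le_log_iff_exp_le (by norm_num)]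
  have h := Real.exp_bound' (x := 2 / 5) (by norm_num) (by norm_num) (n := 4) (by norm_num)
  refine h.trans ?_
  norm_num [Finset.sum_range_succ, Nat.factorial]

lemma log_three_halves_le : Real.log (3 / 2) ≤ 3 / 5 := by
  have := Real.log_le_sub_one_of_pos (show (0 : ℝ) < 3 / 2 by norm_num)
  linarith

/-- A loser is much higher than the winner, or descends, or is low. -/
lemma logLevel_trichotomy {d e d' : ℝ} (h : 4 < e → d' ≤ 2 + max 0 (d - e)) :
    logLevel e + 2 / 5 ≤ logLevel d ∨ logLevel d' ≤ logLevel d - 2 / 5 ∨ logLevel d ≤ 3 / 5 := by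
  -- Both cut points come from the ratio 3/2: below 6 the level is at most log(6/4), and 2/3·d has
  -- level log(d/6), which is log(3/2) below the level of d. If e exceeds 2/3·d ≥ 4, both 2 and d -
  -- e are at most d/3, so d' ≤ 2/3·d.
  by_cases h6 : d < 6
  · refine Or.inr (Or.inr (le_trans ?_ log_three_halves_le))
    refine Real.log_le_log (lt_of_lt_of_le one_pos (le_max_left _ _)) (max_le (by norm_num) ?_)
    linarith
  push Not at h6
  have hl := two_fifths_le_log
  have e1 : logLevel d = Real.log (3 / 2) + Real.log (d / 6) := by
    rw [logLevel, max_eq_right (by linarith), ← Real.log_mul (by norm_num) (by positivity)]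
    congr 1
    ring
  by_cases h7 : e ≤ 2 / 3 * d
  · left
    have : logLevel e ≤ Real.log (d / 6) := by
      refine Real.log_le_log (lt_of_lt_of_le one_pos (le_max_left _ _)) (max_le ?_ ?_) <;> linarith
    linarith
  · right; left
    push Not at h7
    have h8 := h (by linarith)
    have : logLevel d' ≤ Real.log (d / 6) := by
      refine Real.log_le_log (lt_of_lt_of_le one_pos (le_max_left _ _)) (max_le (by linarith) ?_)
      rcases le_total 0 (d - e) with h9 | h9
      · rw [max_eq_right h9] at h8
        linarith
      · rw [max_eq_left h9] at h8
        linarith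
    linarith

lemma log_one_add_two_mul_le {a b : ℝ} (ha : 0 < a) (hb : 0 < b) {x : ℝ} (hx : 0 ≤ x)
    (h : a ≤ (1 + 2 * Real.exp x) * b) : Real.log (a / b) ≤ 2 + x := by
  rw [Real.log_le_iff_le_exp (by positivity), div_le_iff₀ hb, Real.exp_add]
  have h1 : 3 ≤ Real.exp 2 := by
    have := Real.add_one_le_exp (2 : ℝ)
    linarith
  have h2 : 1 ≤ Real.exp x := Real.one_le_exp hx
  refine h.trans (mul_le_mul_of_nonneg_right ?_ hb.le)
  nlinarith

lemma level_trichotomy_of_left_wins {s t : ℕ} (R : ℕ) (hs : 0 < s) (ht : 0 < t) :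
    level s (t + R) + 2 / 5 ≤ level t R ∨ level t (s - 1) ≤ level t R - 2 / 5 ∨
      level t R ≤ 3 / 5 := by
  refine logLevel_trichotomy fun he => ?_
  have h1 : (1 : ℝ) ≤ t := by exact_mod_cast ht
  have h2 : (1 : ℝ) ≤ s := by exact_mod_cast hs
  have h3 : (0 : ℝ) ≤ R := by positivity
  set d := Real.log ((t + R : ℝ) / t) with hd
  set e := Real.log ((s + (t + R : ℕ) : ℝ) / s) with hedef
  have hd' : Real.exp d * t = t + R := by
    rw [hd, Real.exp_log (by positivity), div_mul_cancel₀ _ (by positivity)]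
  have he' : Real.exp e * s = s + (t + R) := by
    rw [hedef, Real.exp_log (by positivity), div_mul_cancel₀ _ (by positivity)]
    push_cast
    ring
  -- The winner has at most half of the total size s + t + R, so t + R is at least half of it. This
  -- is the source of the factor 2 in `key`.
  have he2 : 2 ≤ Real.exp e := by linarith [Real.add_one_le_exp e]
  have hx : Real.exp (d - e) ≤ Real.exp (max 0 (d - e)) := Real.exp_le_exp.2 (le_max_right _ _)
  rw [Real.exp_sub, div_le_iff₀ (Real.exp_pos e)] at hx
  refine log_one_add_two_mul_le (by positivity) (by linarith) (le_max_left _ _) ?_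
  have hs1 : ((s - 1 : ℕ) : ℝ) ≤ s := by exact_mod_cast Nat.sub_le s 1
  have key : (s : ℝ) ≤ 2 * Real.exp (max 0 (d - e)) * t := by
    have h4 : Real.exp e * s ≤ 2 * (Real.exp d * t) := by nlinarith
    have h5 : Real.exp d * t ≤ Real.exp (max 0 (d - e)) * Real.exp e * t :=
      mul_le_mul_of_nonneg_right hx (by linarith)
    refine le_of_mul_le_mul_left ?_ (Real.exp_pos e)
    linarith
  linarith

lemma level_trichotomy_of_right_wins {s t : ℕ} (R : ℕ) (hs : 0 < s) (ht : 0 < t) :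
    level t R + 2 / 5 ≤ level s (t + R) ∨ level s (t - 1) ≤ level s (t + R) - 2 / 5 ∨
      level s (t + R) ≤ 3 / 5 := by
  refine logLevel_trichotomy fun he => ?_
  have h1 : (1 : ℝ) ≤ t := by exact_mod_cast ht
  have h2 : (1 : ℝ) ≤ s := by exact_mod_cast hs
  have h3 : (0 : ℝ) ≤ R := by positivity
  set e := Real.log ((t + R : ℝ) / t) with hedef
  set d := Real.log ((s + (t + R : ℕ) : ℝ) / s) with hd
  have he' : Real.exp e * t = t + R := by
    rw [hedef, Real.exp_log (by positivity), div_mul_cancel₀ _ (by positivity)]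
  have hd' : Real.exp d * s = s + (t + R) := by
    rw [hd, Real.exp_log (by positivity), div_mul_cancel₀ _ (by positivity)]
    push_cast
    ring
  have hx : Real.exp (d - e) ≤ Real.exp (max 0 (d - e)) := Real.exp_le_exp.2 (le_max_right _ _)
  rw [Real.exp_sub, div_le_iff₀ (Real.exp_pos e)] at hx
  refine log_one_add_two_mul_le (by positivity) (by linarith) (le_max_left _ _) ?_
  have ht1 : ((t - 1 : ℕ) : ℝ) ≤ t := by exact_mod_cast Nat.sub_le t 1
  have key : (t : ℝ) ≤ Real.exp (max 0 (d - e)) * s := by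
    have h5 : Real.exp d * s ≤ Real.exp (max 0 (d - e)) * Real.exp e * s :=
      mul_le_mul_of_nonneg_right hx (by linarith)
    refine le_of_mul_le_mul_left ?_ (Real.exp_pos e)
    linarith
  nlinarith [Real.exp_pos (max 0 (d - e))]

open Forest

/-! ### Marked forests and their energy -/

/-- The marks of a node: whether its item is temporary, whether the link to its parent is going to
be cut by the deletion of a temporary parent, whether it has already won a link in the current
deletion, and its base level. -/
structure Mark where
  temp : Bool
  planned : Bool
  won : Bool
  base : ℝ

/-- A forest of marked nodes. -/
inductive MForest where
  | nil : MForest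
  | cons (x : Mark) (children : MForest) (rest : MForest) : MForest

namespace MForest

/-- The number of nodes reachable from the real children in a list of children. A child is real if
it is temporary and its link is planned to be cut by a deletion. -/
def size : MForest → ℕ
  | nil => 0
  | cons x c r => (if x.planned && x.temp then 1 + size c else 0) + size r

/-- The total size of the temporary roots in a list of roots. -/
def rootSize : MForest → ℕ
  | nil => 0
  | cons x c r => (if x.temp then 1 + size c else 0) + rootSize r

/-- The number of roots. -/
def length : MForest → ℕ
  | nil => 0
  | cons _ _ r => 1 + length r

/-- The number of permanent roots. -/
def permanentRoots : MForest → ℕ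
  | nil => 0
  | cons x _ r => (if x.temp then 0 else 1) + permanentRoots r

/-- The number of roots that are permanent or have not won a link yet. -/
def freshRoots : MForest → ℕ
  | nil => 0
  | cons x _ r => (if x.temp && x.won then 0 else 1) + freshRoots r

/-- The variation of the gauged base levels of the real children in a list, starting from `h`. -/
noncomputable def variation (N : ℕ) : ℝ → MForest → ℝ
  | _, nil => 0
  | h, cons x _ r =>
    if x.planned && x.temp then |h - gauge N 0 x.base| + variation N (gauge N 0 x.base) r
    else variation N h r

/-- The variation of the gauged base levels of the temporary roots, starting from level `b`. -/
noncomputable def rootVariation (N j : ℕ) : ℝ → MForest → ℝ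
  | _, nil => 0
  | b, cons x _ r =>
    if x.temp then |gauge N j b - gauge N j x.base| + rootVariation N j x.base r
    else rootVariation N j b r

/-- The energy of a list of children. -/
noncomputable def energy (N : ℕ) : MForest → ℝ
  | nil => 0
  | cons x c r =>
    ((if x.planned then 200 else 0) +
      if x.planned && x.temp then
        6400 * gauge N 0 (level (1 + size c) (size r)) - 400 * x.base +
          800 * variation N (gauge N 0 (level (1 + size c) (size r))) c
      else 800 * variation N 0 c) + energy N c + energy N r

/-- The part of the energy of a temporary root of level `f` that depends on its base level. -/
noncomputable def rootTerm (N : ℕ) (won : Bool) (f b : ℝ) : ℝ :=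
  6400 * gauge N 0 f - 400 * b + 200 * (1 - min f 1) +
    if won then 400 * min (f - b) (1 / 2) else 0

/-- The energy of a root of level `f` with list of children `c`. -/
noncomputable def rootNodeEnergy (N : ℕ) (x : Mark) (c : MForest) (f : ℝ) : ℝ :=
  200 + (if x.temp then rootTerm N x.won f x.base + 800 * variation N (gauge N 0 f) c
    else 800 * variation N 0 c) + energy N c

/-- The energy of a list of roots. -/
noncomputable def rootEnergy (N : ℕ) : MForest → ℝ
  | nil => 0
  | cons x c r => rootNodeEnergy N x c (level (1 + size c) (rootSize r)) + rootEnergy N r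

lemma variation_nonneg (N : ℕ) : ∀ (h : ℝ) (A : MForest), 0 ≤ variation N h A
  | _, nil => le_rfl
  | h, cons x _ r => by
    unfold variation
    split_ifs
    · exact add_nonneg (abs_nonneg _) (variation_nonneg N _ r)
    · exact variation_nonneg N _ r

lemma variation_le (N : ℕ) (h h' : ℝ) :
    ∀ A : MForest, variation N h A ≤ |h - h'| + variation N h' A
  | nil => by simp [variation]
  | cons x _ r => by
    unfold variation
    split_ifs
    · linarith [abs_sub_le h h' (gauge N 0 x.base)]
    · exact variation_le N h h' r

lemma rootVariation_nonneg (N j : ℕ) : ∀ (b : ℝ) (A : MForest), 0 ≤ rootVariation N j b A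
  | _, nil => le_rfl
  | b, cons x _ r => by
    unfold rootVariation
    split_ifs
    · exact add_nonneg (abs_nonneg _) (rootVariation_nonneg N j _ r)
    · exact rootVariation_nonneg N j _ r

lemma rootVariation_le (N j : ℕ) (b b' : ℝ) :
    ∀ A : MForest, rootVariation N j b A ≤ |gauge N j b - gauge N j b'| + rootVariation N j b' A
  | nil => by simp [rootVariation]
  | cons x _ r => by
    unfold rootVariation
    split_ifs
    · linarith [abs_sub_le (gauge N j b) (gauge N j b') (gauge N j x.base)]
    · exact rootVariation_le N j b b' r

lemma rootVariation_succ_le (N j : ℕ) :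
    ∀ (b : ℝ) (A : MForest), rootVariation N (j + 1) b A ≤ rootVariation N j b A
  | _, nil => le_rfl
  | b, cons x _ r => by
    unfold rootVariation
    split_ifs
    · exact add_le_add (abs_gauge_succ_le N j _ _) (rootVariation_succ_le N j _ r)
    · exact rootVariation_succ_le N j _ r

end MForest

open MForest

/-! ### The scalar inequalities -/

lemma min_sub_le {b f f' : ℝ} (hb : b ≤ f) (h : f' ≤ f) : b - min b f' ≤ f - f' := by
  rcases min_cases b f' with ⟨h1, _⟩ | ⟨h1, _⟩ <;> rw [h1] <;> linarith

lemma gauge_sub_gauge_min_le (N j : ℕ) {b f f' : ℝ} (hb : b ≤ f) (h : f' ≤ f) :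
    gauge N j b - gauge N j (min b f') ≤ gauge N 0 f - gauge N 0 f' := by
  rcases min_cases b f' with ⟨h1, _⟩ | ⟨h1, h2⟩ <;> rw [h1]
  · linarith [gauge_mono N 0 h]
  · linarith [gauge_sub_le_gauge_sub N j h2.le, gauge_mono N 0 hb]

lemma rootTerm_descend {N : ℕ} (hN : 0 < N) (z : Bool) {f f' b : ℝ} (hb : b ≤ f)
    (hf' : 0 ≤ f') (h : f' ≤ f) :
    rootTerm N z f' (min b f') + 5800 * (gauge N 0 f - gauge N 0 f') ≤ rootTerm N z f b := by
  have h1 := sub_le_gauge_sub hN hf' h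
  have h2 := min_sub_le hb h
  have h3 : min f 1 - min f' 1 ≤ f - f' := by
    rcases min_cases f 1 with ⟨h1, _⟩ | ⟨h1, _⟩ <;> rcases min_cases f' 1 with ⟨h2, _⟩ | ⟨h2, _⟩ <;>
      rw [h1, h2] <;> linarith
  have h4 : f' - min b f' ≤ f - b := by linarith
  have h5 : min (f' - min b f') (1 / 2) ≤ min (f - b) (1 / 2) := min_le_min h4 le_rfl
  unfold rootTerm
  split_ifs <;> linarith

/-- The base is at most the level, which is at most its gauge, so the negative term consumes only
400 of the 6400. What remains is spent when the loser becomes a nonreal child. -/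
lemma le_rootTerm {N : ℕ} (hN : 0 < N) (z : Bool) {f b : ℝ} (hb0 : 0 ≤ b) (hb : b ≤ f) :
    6000 * gauge N 0 f ≤ rootTerm N z f b := by
  have h1 := le_gauge hN (hb0.trans hb)
  have h2 : 0 ≤ 1 - min f 1 := by linarith [min_le_right f 1]
  have h3 : 0 ≤ min (f - b) (1 / 2) := le_min (by linarith) (by norm_num)
  unfold rootTerm
  split_ifs <;> linarith

/-- The loser has level f and base a, the winner level g and base b, and primes denote levels after
the link. Raising the loser's base from a to about g releases about g - a, which is g - b up to |a -
b|, and so funds the winner's surplus of level over base. The bound E allows for a rise of the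
loser's gauge. -/
lemma rootTerm_link {N : ℕ} (hN : 0 < N) (z y : Bool) {f g f' g' a b E : ℝ}
    (haf : a ≤ f) (hb0 : 0 ≤ b) (hbg : b ≤ g) (hf' : 0 ≤ f') (hg' : 0 ≤ g')
    (hgg : g' ≤ g) (hgf : g' ≤ f) (hE : 0 ≤ E) (hff : gauge N 0 f' ≤ gauge N 0 f + E)
    (htri : g + 2 / 5 ≤ f ∨ f' ≤ f - 2 / 5 ∨ f ≤ 3 / 5) :
    6400 * gauge N 0 f' - 400 * min g f' + 800 * |gauge N 0 f' - gauge N 0 f| +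
      rootTerm N true g' (min b g') +
      800 * (gauge N 0 g - gauge N 0 g' + 2 * (gauge N 0 g - gauge N 0 (min g f'))) +
      1600 * (gauge N 0 g - gauge N 0 g') + (if z then 80 else 0) ≤
    rootTerm N z f a + rootTerm N y g b + 800 * |a - b| + 7200 * E := by
  have hX := sub_le_gauge_sub hN hg' hgg
  have h2 := min_sub_le hbg hgg
  have h3 : min g 1 - min g' 1 ≤ g - g' := by
    rcases min_cases g 1 with ⟨h1, _⟩ | ⟨h1, _⟩ <;> rcases min_cases g' 1 with ⟨h2, _⟩ | ⟨h2, _⟩ <;>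
      rw [h1, h2] <;> linarith
  have h4 : min (g' - min b g') (1 / 2) ≤ g - b :=
    (min_le_left _ _).trans (by linarith)
  have hgf0 := gauge_mono N 0 hgf
  have hkey : gauge N 0 g - gauge N 0 (min g f') ≤
      max (gauge N 0 f - gauge N 0 f') 0 + (gauge N 0 g - gauge N 0 g') := by
    rcases min_cases g f' with ⟨h1, _⟩ | ⟨h1, _⟩ <;> rw [h1]
    · linarith [le_max_right (gauge N 0 f - gauge N 0 f') 0, gauge_mono N 0 hgg]
    · linarith [le_max_left (gauge N 0 f - gauge N 0 f') 0]
  have hkey2 : g - min g f' ≤ gauge N 0 g - gauge N 0 (min g f') :=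
    sub_le_gauge_sub hN (le_min (hb0.trans hbg) hf') (min_le_left _ _)
  have hy : 0 ≤ (if y then 400 * min (g - b) (1 / 2) else 0 : ℝ) := by
    have : 0 ≤ min (g - b) (1 / 2) := le_min (by linarith) (by norm_num)
    split_ifs <;> linarith
  -- The three cases of the trichotomy yield 400·2/5 from the surplus together with |a - b|,
  -- 3600·2/5 from the descent, and 200·(1 - 3/5) = 80 from the low charge.
  have hz : (if z then 80 else 0 : ℝ) ≤ 200 * (1 - min f 1) +
      (if z then 400 * min (f - a) (1 / 2) else 0) + 400 * |a - b| +
        3600 * max (gauge N 0 f - gauge N 0 f') 0 := by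
    have e1 : 0 ≤ 1 - min f 1 := by linarith [min_le_right f 1]
    have e2 := abs_nonneg (a - b)
    have e3 := le_max_right (gauge N 0 f - gauge N 0 f') 0
    have e4 : 0 ≤ min (f - a) (1 / 2) := le_min (by linarith) (by norm_num)
    cases z
    · simp only [Bool.false_eq_true, if_false]
      linarith
    · simp only [if_true]
      rcases htri with h | h | h
      · have : 2 / 5 - |a - b| ≤ min (f - a) (1 / 2) := by
          refine le_min ?_ (by linarith)
          linarith [le_abs_self (a - b)]
        linarith
      · have := sub_le_gauge_sub hN hf' (show f' ≤ f by linarith)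
        linarith [le_max_left (gauge N 0 f - gauge N 0 f') 0]
      · linarith [min_le_left f 1]
  have hab := le_abs_self (a - b)
  -- The coefficient 6400 splits as 800 for the variation among the loser's children, 3600 for `hz`,
  -- 1600 for the variation among the winner's children and 400 for the cap on the new base. If the
  -- loser rises, the cost is 6400 + 800 = 7200 per unit.
  have hfin : -6400 * (gauge N 0 f - gauge N 0 f') + 800 * |gauge N 0 f' - gauge N 0 f| +
      5600 * max (gauge N 0 f - gauge N 0 f') 0 ≤ 7200 * E := by
    rcases le_total (gauge N 0 f - gauge N 0 f') 0 with h | h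
    · rw [max_eq_right h, abs_of_nonneg (by linarith)]
      linarith
    · rw [max_eq_left h, abs_of_nonpos (by linarith)]
      linarith
  unfold rootTerm
  simp only [if_true]
  linarith

/-! ### One link of a pairing pass -/

lemma variation_gauge_le (N : ℕ) {f f' : ℝ} (h : f' ≤ f) (c : MForest) :
    variation N (gauge N 0 f') c ≤
      gauge N 0 f - gauge N 0 f' + variation N (gauge N 0 f) c := by
  have h1 := MForest.variation_le N (gauge N 0 f') (gauge N 0 f) c
  rwa [abs_of_nonpos (by linarith [gauge_mono N 0 h]), neg_sub] at h1

/-- Lowering a base level changes the variation by at most twice the decrease of the gauge. -/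
lemma rootVariation_lower_le (N j : ℕ) {b b₁ c δ : ℝ} (h : b₁ ≤ b)
    (hδ : gauge N j b - gauge N j b₁ ≤ δ) (d : ℝ) (B : MForest) :
    |gauge N j c - gauge N j b₁| + rootVariation N j b₁ B ≤
      |gauge N j c - gauge N j b| + |gauge N j b - gauge N j d| + rootVariation N j d B + 2 * δ := by
  have h0 : |gauge N j b - gauge N j b₁| ≤ δ := by
    rwa [abs_of_nonneg (sub_nonneg.2 (gauge_mono N j h))]
  have h1 := MForest.rootVariation_le N j b₁ d B
  have h2 := abs_sub_le (gauge N j c) (gauge N j b) (gauge N j b₁)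
  have h3 := abs_sub_le (gauge N j b₁) (gauge N j b) (gauge N j d)
  rw [abs_sub_comm (gauge N j b₁) (gauge N j b)] at h3
  linarith

lemma rootNodeEnergy_descend {N : ℕ} (hN : 0 < N) (x : Mark) (c : MForest) {f f' : ℝ}
    (hb : x.temp → x.base ≤ f) (hf' : 0 ≤ f') (h : f' ≤ f) :
    rootNodeEnergy N { x with base := min x.base f' } c f' +
      (if x.temp then 5000 * (gauge N 0 f - gauge N 0 f') else 0) ≤ rootNodeEnergy N x c f := by
  unfold rootNodeEnergy
  cases hx : x.temp
  · simp
  · have h1 := rootTerm_descend hN x.won (hb hx) hf' h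
    have h2 := variation_gauge_le N h c
    simp only [if_true]
    linarith

/-- Besides `rootTerm_link`, the root list must be updated: the loser's base leaves it and the
winner's base drops. The jump between the two bases is split by `abs_sub_le_threshold_add` into a
payment for |b₁ - b₂| and a remaining jump for the next gauge. -/
lemma real_link_energy {N j : ℕ} (hN : 0 < N) (hj : j < N) (l w : Mark) (cl cw A B : MForest)
    {f₀ f f' g₀ g g' E S S' b b₁ b₂ : ℝ} (hlt : l.temp = true) (hwt : w.temp = true)
    (hl0 : 0 ≤ l.base) (hl : l.base ≤ f₀) (hw0 : 0 ≤ w.base) (hw : w.base ≤ g₀)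
    (hf0 : 0 ≤ f) (hf : f ≤ f₀) (hg : g ≤ g₀) (hf' : 0 ≤ f') (hg' : 0 ≤ g') (hgg : g' ≤ g)
    (hgf : g' ≤ f) (hE : 0 ≤ E) (hff : gauge N 0 f' ≤ gauge N 0 f + E)
    (htri : g + 2 / 5 ≤ f ∨ f' ≤ f - 2 / 5 ∨ f ≤ 3 / 5)
    (hlevel : level (1 + size cl) (size cw) = f')
    (hb12 : (b₁ = l.base ∧ b₂ = w.base) ∨ (b₁ = w.base ∧ b₂ = l.base))
    (hrest : ∀ c, 0 ≤ c → rootEnergy N B + 800 * rootVariation N (j + 1) c B + S' ≤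
      rootEnergy N A + 800 * rootVariation N j c A + S) :
    rootNodeEnergy N { w with won := true, base := min (min w.base g) g' }
        (.cons { l with planned := true, base := min g f' } cl cw) g' + rootEnergy N B +
      800 * (|gauge N (j + 1) b - gauge N (j + 1) (min (min w.base g) g')| +
        rootVariation N (j + 1) (min (min w.base g) g') B) + S' + (if l.won then 80 else 0) ≤
    rootNodeEnergy N l cl f₀ + rootNodeEnergy N w cw g₀ + rootEnergy N A +
      800 * (|gauge N j b - gauge N j b₁| + |gauge N j b₁ - gauge N j b₂| +
        rootVariation N j b₂ A) + S + 800 * threshold j + 7200 * E := by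
  have hg0 : 0 ≤ g := hg'.trans hgg
  -- The total size on the right may already have shrunk during this pass. Hence both roots first
  -- descend from f₀, g₀ to f, g, and only then are they linked.
  have d1 := rootNodeEnergy_descend hN l cl (fun _ => hl) hf0 hf
  have d2 := rootNodeEnergy_descend hN w cw (fun _ => hw) hg0 hg
  have m1 := min_sub_le hl hf
  have m2 := min_sub_le hw hg
  have s1 := sub_le_gauge_sub hN hf0 hf
  have s2 := sub_le_gauge_sub hN hg0 hg
  have r1 := rootTerm_link hN l.won w.won (a := min l.base f) (b := min w.base g)
    (min_le_right _ _) (le_min hw0 hg0) (min_le_right _ _) hf' hg' hgg hgf hE hff htri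
  have v1 := MForest.variation_le N (gauge N 0 f') (gauge N 0 f) cl
  have hmin : min g f' ≤ g := min_le_left _ _
  have v2 := variation_gauge_le N hmin cw
  have v3 : |gauge N 0 g' - gauge N 0 (min g f')| ≤
      gauge N 0 g - gauge N 0 g' + (gauge N 0 g - gauge N 0 (min g f')) := by
    have e1 := abs_sub_le (gauge N 0 g') (gauge N 0 g) (gauge N 0 (min g f'))
    rw [abs_sub_comm (gauge N 0 g') (gauge N 0 g), abs_of_nonneg (sub_nonneg.2 (gauge_mono N 0 hgg)),
      abs_of_nonneg (sub_nonneg.2 (gauge_mono N 0 hmin))] at e1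
    exact e1
  have hdiff : |min l.base f - min w.base g| ≤ |b₁ - b₂| + (f₀ - f) + (g₀ - g) := by
    have e0 : |l.base - w.base| = |b₁ - b₂| := by
      rcases hb12 with ⟨rfl, rfl⟩ | ⟨rfl, rfl⟩
      · rfl
      · exact abs_sub_comm _ _
    rw [← e0]
    have e1 := min_le_left l.base f
    have e2 := min_le_left w.base g
    have e3 := le_abs_self (l.base - w.base)
    have e4 := neg_abs_le (l.base - w.base)
    rw [abs_le]
    constructor <;> linarith
  have hb1 : 0 ≤ b₁ := by rcases hb12 with ⟨rfl, rfl⟩ | ⟨rfl, rfl⟩ <;> assumption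
  have hb2 : 0 ≤ b₂ := by rcases hb12 with ⟨rfl, rfl⟩ | ⟨rfl, rfl⟩ <;> assumption
  have t1 := abs_sub_le_threshold_add hj hb1 hb2
  have q1 := gauge_sub_gauge_min_le N (j + 1) hw hg
  have q2 := gauge_sub_gauge_min_le N (j + 1) (min_le_right w.base g) hgg
  have t2 := rootVariation_lower_le N (j + 1) (c := b)
    ((min_le_left (min w.base g) g').trans (min_le_left _ _))
    (show gauge N (j + 1) w.base - gauge N (j + 1) (min (min w.base g) g') ≤
      (gauge N 0 g₀ - gauge N 0 g) + (gauge N 0 g - gauge N 0 g') by linarith) b₂ B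
  have t3 : |gauge N (j + 1) b - gauge N (j + 1) w.base| +
      |gauge N (j + 1) w.base - gauge N (j + 1) b₂| ≤
      |gauge N j b - gauge N j b₁| + |gauge N (j + 1) b₁ - gauge N (j + 1) b₂| := by
    have e1 := abs_gauge_succ_le N j b b₁
    rcases hb12 with ⟨h1, h2⟩ | ⟨h1, h2⟩
    · rw [h2, sub_self, abs_zero, ← h2]
      linarith [abs_sub_le (gauge N (j + 1) b) (gauge N (j + 1) b₁) (gauge N (j + 1) b₂)]
    · rw [← h1]
      linarith
  have q := hrest b₂ hb2
  have hw' : rootNodeEnergy N { w with won := true, base := min (min w.base g) g' }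
      (.cons { l with planned := true, base := min g f' } cl cw) g' =
      200 + (rootTerm N true g' (min (min w.base g) g') + 800 *
        (|gauge N 0 g' - gauge N 0 (min g f')| + variation N (gauge N 0 (min g f')) cw)) +
      (200 + (6400 * gauge N 0 f' - 400 * min g f' + 800 * variation N (gauge N 0 f') cl) +
        energy N cl + energy N cw) := by
    simp [rootNodeEnergy, energy, variation, hlt, hwt, hlevel]
  rw [hw']
  unfold rootNodeEnergy at d1 d2 ⊢
  simp only [hlt, hwt, if_true] at d1 d2 ⊢
  linarith

/-- The loser vanishes from all sizes and variations, so its whole level-dependent energy is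
released. This pays for restarting the variation of its children at 0. An unplanned link also
releases the 200 units that every root carries, while a planned one keeps them until it is cut. -/
lemma nonreal_link_energy {N j : ℕ} (hN : 0 < N) (l w l' : Mark) (cl cw A B : MForest)
    {f₀ g₀ g S S' b : ℝ} (hl : l.temp → 0 ≤ l.base ∧ l.base ≤ f₀)
    (hw : w.temp → 0 ≤ w.base ∧ w.base ≤ g₀) (hg0 : 0 ≤ g) (hg : g ≤ g₀) (hb : 0 ≤ b)
    (hl' : (l'.planned && l'.temp) = false)
    {x₁ x₂ : Mark} {c₁ c₂ : MForest}
    (hx : (x₁ = l ∧ x₂ = w) ∨ (x₁ = w ∧ x₂ = l))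
    (hrest : ∀ c, 0 ≤ c → rootEnergy N B + 800 * rootVariation N (j + 1) c B + S' ≤
      rootEnergy N A + 800 * rootVariation N j c A + S) :
    rootNodeEnergy N { w with base := min w.base g } (.cons l' cl cw) g + rootEnergy N B +
      800 * rootVariation N (j + 1) b
        (.cons { w with base := min w.base g } (.cons l' cl cw) B) + S' +
      (if l'.planned then 0 else 200) ≤
    rootNodeEnergy N l cl f₀ + rootNodeEnergy N w cw g₀ + rootEnergy N A +
      800 * rootVariation N j b (.cons x₁ c₁ (.cons x₂ c₂ A)) + S := by
  have hloser : (if l'.planned then 200 else 0) + 800 * variation N 0 cl + energy N cl +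
      (if l'.planned then 0 else 200) ≤ rootNodeEnergy N l cl f₀ := by
    have e1 : (if l'.planned then 200 else 0 : ℝ) + (if l'.planned then 0 else 200) = 200 := by
      split_ifs <;> norm_num
    unfold rootNodeEnergy
    cases ht : l.temp
    · simp only [Bool.false_eq_true, if_false]
      linarith
    · have h1 := le_rootTerm hN l.won (hl ht).1 (hl ht).2
      have h2 := variation_gauge_le N ((hl ht).1.trans (hl ht).2) cl
      have h3 := gauge_mono N 0 ((hl ht).1.trans (hl ht).2)
      simp only [gauge_zero] at h2 h3
      simp only [if_true]
      linarith
  have d2 := rootNodeEnergy_descend hN w cw (fun h => (hw h).2) hg0 hg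
  have hwin : rootNodeEnergy N { w with base := min w.base g } (.cons l' cl cw) g =
      rootNodeEnergy N { w with base := min w.base g } cw g +
        ((if l'.planned then 200 else 0) + 800 * variation N 0 cl + energy N cl) := by
    simp only [rootNodeEnergy, variation, energy, hl']
    cases w.temp <;> simp <;> ring
  have htv : rootEnergy N B + 800 * rootVariation N (j + 1) b
      (.cons { w with base := min w.base g } (.cons l' cl cw) B) + S' ≤
      rootEnergy N A + 800 * rootVariation N j b (.cons x₁ c₁ (.cons x₂ c₂ A)) + S +
      (if w.temp then 5000 * (gauge N 0 g₀ - gauge N 0 g) else 0) := by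
    cases hwt : w.temp
    · have q := hrest b hb
      cases hlt : l.temp
      · rcases hx with ⟨rfl, rfl⟩ | ⟨rfl, rfl⟩ <;> simp [rootVariation, hlt, hwt] <;> linarith
      · have q2 := hrest l.base (hl hlt).1
        have q3 := MForest.rootVariation_le N (j + 1) b l.base B
        have q4 := abs_gauge_succ_le N j b l.base
        rcases hx with ⟨rfl, rfl⟩ | ⟨rfl, rfl⟩ <;> simp [rootVariation, hlt, hwt] <;> linarith
    · have hmono := gauge_mono N 0 hg
      have p1 := gauge_sub_gauge_min_le N (j + 1) (hw hwt).2 hg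
      have t1 := rootVariation_lower_le N (j + 1) (c := b) (min_le_left w.base g) p1
      cases hlt : l.temp
      · have t2 := t1 w.base B
        have q := hrest w.base (hw hwt).1
        have q4 := abs_gauge_succ_le N j b w.base
        rw [sub_self, abs_zero] at t2
        rcases hx with ⟨rfl, rfl⟩ | ⟨rfl, rfl⟩ <;> simp [rootVariation, hlt, hwt] <;> linarith
      · rcases hx with ⟨rfl, rfl⟩ | ⟨rfl, rfl⟩
        · have t2 := t1 x₂.base B
          have q := hrest x₂.base (hw hwt).1
          rw [sub_self, abs_zero] at t2
          have q4 := abs_gauge_succ_le N j b x₂.base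
          have q5 := abs_sub_le (gauge N j b) (gauge N j x₁.base) (gauge N j x₂.base)
          simp [rootVariation, hlt, hwt]
          linarith
        · have t2 := t1 x₂.base B
          have q := hrest x₂.base (hl hlt).1
          have q4 := abs_gauge_succ_le N j b x₁.base
          have q5 := abs_gauge_succ_le N j x₁.base x₂.base
          simp [rootVariation, hlt, hwt]
          linarith
  rw [hwin]
  linarith

/-! ### Marking a forest -/

/-- The marked forest `A` describes the list `F` of children of a node that is temporary
if `p` is true. Here `T e` says that the item `e` is temporary, and `fl e` that the next cut of
the node of `e` is due to a deletion of its parent. -/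
def Represents {α κ : Type*} (T fl : α → Bool) : Bool → Forest α κ → MForest → Prop
  | _, .nil, .nil => True
  | p, .cons e _ c r, .cons x c' r' =>
    x.temp = T e ∧ x.planned = (fl e && p) ∧
      ((x.planned && x.temp) = true →
        0 ≤ x.base ∧ x.base ≤ level (1 + size c') (size r')) ∧
      Represents T fl (T e) c c' ∧ Represents T fl p r r'
  | _, .nil, .cons _ _ _ => False
  | _, .cons _ _ _ _, .nil => False

/-- The marked forest `A` describes the list `F` of roots. -/
def RepresentsRoots {α κ : Type*} (T fl : α → Bool) : Forest α κ → MForest → Prop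
  | .nil, .nil => True
  | .cons e _ c r, .cons x c' r' =>
    x.temp = T e ∧
      (x.temp = true → 0 ≤ x.base ∧ x.base ≤ level (1 + size c') (rootSize r')) ∧
      Represents T fl (T e) c c' ∧ RepresentsRoots T fl r r'
  | .nil, .cons _ _ _ => False
  | .cons _ _ _ _, .nil => False

lemma RepresentsRoots.exists_cons {α κ : Type*} {T fl : α → Bool} {e : α} {k : κ}
    {c r : Forest α κ} {A : MForest} (h : RepresentsRoots T fl (.cons e k c r) A) :
    ∃ x c' r', A = .cons x c' r' ∧ x.temp = T e ∧
      (x.temp = true → 0 ≤ x.base ∧ x.base ≤ level (1 + size c') (rootSize r')) ∧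
      Represents T fl (T e) c c' ∧ RepresentsRoots T fl r r' := by
  cases A with
  | nil => exact h.elim
  | cons x c' r' => exact ⟨x, c', r', rfl, h⟩

lemma RepresentsRoots.eq_nil {α κ : Type*} {T fl : α → Bool} {A : MForest}
    (h : RepresentsRoots T fl (.nil : Forest α κ) A) : A = .nil := by
  cases A with
  | nil => rfl
  | cons x c' r' => exact h.elim

lemma Represents.exists_cons {α κ : Type*} {T fl : α → Bool} {p : Bool} {e : α} {k : κ}
    {c r : Forest α κ} {A : MForest} (h : Represents T fl p (.cons e k c r) A) :
    ∃ x c' r', A = .cons x c' r' ∧ x.temp = T e ∧ x.planned = (fl e && p) ∧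
      ((x.planned && x.temp) = true →
        0 ≤ x.base ∧ x.base ≤ level (1 + size c') (size r')) ∧
      Represents T fl (T e) c c' ∧ Represents T fl p r r' := by
  cases A with
  | nil => exact h.elim
  | cons x c' r' => exact ⟨x, c', r', rfl, h⟩

lemma Represents.eq_nil {α κ : Type*} {T fl : α → Bool} {p : Bool} {A : MForest}
    (h : Represents T fl p (.nil : Forest α κ) A) : A = .nil := by
  cases A with
  | nil => rfl
  | cons x c' r' => exact h.elim

/-! ### Pairing passes -/

/-- Weighted arithmetic-geometric mean inequality. The constant works because 1000·172800000² <
3·10^19. -/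
lemma mul_sqrt_le {ρ δ : ℝ} (hρ : 0 < ρ) (hδ : 0 ≤ δ) :
    7200 * (24000 * Real.sqrt δ) ≤ ρ / 4000 + 3 * 10 ^ 19 / ρ * δ := by
  have h1 := Real.sq_sqrt hδ
  set y := Real.sqrt δ
  rw [← h1, ← sub_nonneg]
  have : ρ / 4000 + 3 * 10 ^ 19 / ρ * y ^ 2 - 7200 * (24000 * y) =
      ((ρ / 2000 - 172800000 * y) ^ 2 * 1000 +
        (3 * 10 ^ 19 - 1000 * 172800000 ^ 2) * y ^ 2) / ρ := by
    field_simp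
    ring
  rw [this]
  refine div_nonneg (add_nonneg (by positivity) (mul_nonneg (by norm_num) (by positivity))) hρ.le

/-- The outcome of a pairing pass with index `j` that turns the root list `A` into `B`: a lower bound
for the decrease of the energy in terms of the number `w` of losses of earlier winners and the
number `d` of links that are not planned to be cut by a deletion. -/
structure PassOutcome (N j : ℕ) (A B : MForest) (w d : ℕ) : Prop where
  rootSize_le : rootSize B ≤ rootSize A
  length_eq : length B = (length A + 1) / 2
  permanentRoots_le : permanentRoots B ≤ d + 1
  freshRoots_le : freshRoots B ≤ d + permanentRoots A + 1
  links_le : length A / 2 ≤ w + d + freshRoots A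
  energy_le : ∀ b, 0 ≤ b → rootEnergy N B + 800 * rootVariation N (j + 1) b B +
      (80 * w + 200 * d) ≤
    rootEnergy N A + 800 * rootVariation N j b A +
      ((length A / 2 : ℕ) * (21 / 100 * passWeight j) +
        3 * 10 ^ 19 / passWeight j * Real.log (rootSize B))

lemma PassOutcome.real_link {N j : ℕ} (hN : 0 < N) (hj : j < N) {A B : MForest} {n d : ℕ}
    (h : PassOutcome N j A B n d) {l w x₁ x₂ : Mark} {cl cw c₁ c₂ : MForest}
    (hlt : l.temp = true) (hwt : w.temp = true)
    (hx : (x₁ = l ∧ c₁ = cl ∧ x₂ = w ∧ c₂ = cw) ∨ (x₁ = w ∧ c₁ = cw ∧ x₂ = l ∧ c₂ = cl))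
    (h₁ : x₁.temp = true → 0 ≤ x₁.base ∧
      x₁.base ≤ level (1 + size c₁) (rootSize (.cons x₂ c₂ A)))
    (h₂ : x₂.temp = true → 0 ≤ x₂.base ∧ x₂.base ≤ level (1 + size c₂) (rootSize A)) :
    ∃ a b n', 0 ≤ a ∧ a ≤ level (1 + size cl) (size cw) ∧ 0 ≤ b ∧
      b ≤ level (1 + ((1 + size cl) + size cw)) (rootSize B) ∧
      PassOutcome N j (.cons x₁ c₁ (.cons x₂ c₂ A)) (.cons { w with won := true, base := b }
        (.cons { l with planned := true, base := a } cl cw) B) n' d := by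
  have hρ := passWeight_pos j
  set R := rootSize A with hR
  set R' := rootSize B with hR'
  set s := 1 + size cl with hs
  set t := 1 + size cw with ht
  have hsz : 1 + (s + size cw) = s + t := by omega
  have hszc : size cw = t - 1 := by omega
  have hRR : R' ≤ R := h.rootSize_le
  have hs0 : 0 < s := by omega
  have ht0 : 0 < t := by omega
  have hpw : (3 * 10 ^ 19 / passWeight j : ℝ) ≥ 0 := by positivity
  -- The two orders of loser and winner are unified here. If the right root wins, the loser's level
  -- cannot rise and E = 0; if the left one wins, E is the square root error, converted into a
  -- difference of logarithms that telescopes along the list.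
  have core : ∃ f₀ f g₀ g E : ℝ, l.base ≤ f₀ ∧ w.base ≤ g₀ ∧ 0 ≤ f ∧ f ≤ f₀ ∧ g ≤ g₀ ∧
      level (s + t) R' ≤ g ∧ level (s + t) R' ≤ f ∧ 0 ≤ E ∧
      gauge N 0 (level s (t - 1)) ≤ gauge N 0 f + E ∧
      (g + 2 / 5 ≤ f ∨ level s (t - 1) ≤ f - 2 / 5 ∨ f ≤ 3 / 5) ∧
      rootEnergy N (.cons x₁ c₁ (.cons x₂ c₂ A)) =
        rootNodeEnergy N l cl f₀ + rootNodeEnergy N w cw g₀ + rootEnergy N A ∧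
      7200 * E + 3 * 10 ^ 19 / passWeight j * Real.log R' ≤
        passWeight j / 4000 + 3 * 10 ^ 19 / passWeight j * Real.log ((s + t + R' : ℕ) : ℝ) := by
    rcases hx with ⟨rfl, rfl, rfl, rfl⟩ | ⟨rfl, rfl, rfl, rfl⟩
    · refine ⟨level s (t + R), level s (t + R'), level t R, level t R', 0, ?_, (h₂ hwt).2,
        level_nonneg _ _, level_mono_right hs0 (by omega), level_mono_right ht0 hRR,
        level_add_le_right s t R' ht0, level_add_le_left s t R' hs0, le_rfl, ?_,
        level_trichotomy_of_right_wins R' hs0 ht0, ?_, ?_⟩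
      · have := (h₁ hlt).2
        simpa [rootSize, hwt, ← ht] using this
      · rw [add_zero]
        exact gauge_mono N 0 (level_le_of_right_wins R' hs0)
      · simp only [rootEnergy, rootSize, hwt, if_true, ← ht, ← hs, ← hR]
        ring
      · have := mul_le_mul_of_nonneg_left (log_cast_mono (show R' ≤ s + t + R' by omega)) hpw
        linarith
    · have hδ : 0 ≤ Real.log ((t + s + R' : ℕ) : ℝ) - Real.log ((s + R' : ℕ) : ℝ) :=
        sub_nonneg.2 (log_cast_mono (by omega))
      refine ⟨level s R, level s R', level t (s + R), level t (s + R'), 24000 * Real.sqrt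
        (Real.log ((t + s + R' : ℕ) : ℝ) - Real.log ((s + R' : ℕ) : ℝ)), (h₂ hlt).2, ?_,
        level_nonneg _ _, level_mono_right hs0 hRR, level_mono_right ht0 (by omega), ?_, ?_,
        by positivity, gauge_level_le_of_left_wins N R' ht0 hs0,
        level_trichotomy_of_left_wins R' ht0 hs0, ?_, ?_⟩
      · have := (h₁ hwt).2
        simpa [rootSize, hlt, ← hs] using this
      · rw [add_comm s t]
        exact level_add_le_left t s R' ht0
      · rw [add_comm s t]
        exact level_add_le_right t s R' hs0
      · simp only [rootEnergy, rootSize, hlt, if_true, ← ht, ← hs, ← hR]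
        ring
      · have e1 := mul_le_mul_of_nonneg_left (log_cast_mono (show R' ≤ s + R' by omega)) hpw
        have e2 := mul_sqrt_le hρ hδ
        rw [add_comm s t]
        linarith
  obtain ⟨f₀, f, g₀, g, E, hl, hw, hf0, hf, hg, hgg, hgf, hE, hff, htri, hen, hlog⟩ := core
  have hl0 : 0 ≤ l.base := by
    rcases hx with ⟨rfl, -, -, -⟩ | ⟨-, -, rfl, -⟩
    exacts [(h₁ hlt).1, (h₂ hlt).1]
  have hw0 : 0 ≤ w.base := by
    rcases hx with ⟨-, -, rfl, -⟩ | ⟨rfl, -, -, -⟩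
    exacts [(h₂ hwt).1, (h₁ hwt).1]
  have hg0 : 0 ≤ g := (level_nonneg _ _).trans hgg
  have hb12 : (x₁.base = l.base ∧ x₂.base = w.base) ∨ (x₁.base = w.base ∧ x₂.base = l.base) := by
    rcases hx with ⟨rfl, -, rfl, -⟩ | ⟨rfl, -, rfl, -⟩ <;> simp
  have ht₁ : x₁.temp = true := by rcases hx with ⟨rfl, -⟩ | ⟨rfl, -⟩ <;> assumption
  have ht₂ : x₂.temp = true := by rcases hx with ⟨-, -, rfl, -⟩ | ⟨-, -, rfl, -⟩ <;> assumption
  -- The loser's base is the winner's level, and both bases are capped by the new levels to keep the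
  -- invariant that a base never exceeds its level.
  refine ⟨min g (level s (t - 1)), min (min w.base g) (level (s + t) R'),
    n + (if l.won then 1 else 0), le_min hg0 (level_nonneg _ _), ?_,
    le_min (le_min hw0 hg0) (level_nonneg _ _), ?_, ?_, ?_, ?_, ?_, ?_, ?_⟩
  · rw [hszc]
    exact min_le_right _ _
  · rw [hsz]
    exact min_le_right _ _
  · have := h.rootSize_le
    rcases hx with ⟨rfl, rfl, rfl, rfl⟩ | ⟨rfl, rfl, rfl, rfl⟩ <;>
      simp only [rootSize, size, hlt, hwt, if_true, Bool.and_self] <;> omega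
  · have := h.length_eq
    simp only [length]
    omega
  · have := h.permanentRoots_le
    simp only [permanentRoots, hwt, if_true]
    omega
  · have := h.freshRoots_le
    simp only [freshRoots, permanentRoots, hwt, Bool.and_self, if_true, ht₁, ht₂]
    omega
  · have := h.links_le
    have hc : freshRoots (.cons x₁ c₁ (.cons x₂ c₂ A)) + (if l.won then 1 else 0) ≥
        freshRoots A + 1 := by
      rcases hx with ⟨rfl, -, rfl, -⟩ | ⟨rfl, -, rfl, -⟩ <;> simp only [freshRoots, hlt, Bool.true_and] <;>
        split_ifs <;> omega
    simp only [length] at this ⊢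
    omega
  · intro b hb
    have key := real_link_energy (b := b) hN hj l w cl cw A B hlt hwt hl0 hl hw0 hw hf0 hf hg
      (level_nonneg s (t - 1)) (level_nonneg (s + t) R') hgg hgf hE hff htri
      (by rw [hszc]) hb12 h.energy_le
    set β := min (min w.base g) (level (s + t) R')
    have hroot : rootEnergy N (.cons { w with won := true, base := β }
        (.cons { l with planned := true, base := min g (level s (t - 1)) } cl cw) B) =
        rootNodeEnergy N { w with won := true, base := β }
          (.cons { l with planned := true, base := min g (level s (t - 1)) } cl cw)
          (level (s + t) R') + rootEnergy N B := by
      simp only [rootEnergy, size, hlt, Bool.and_self, if_true, ← hs, hsz, ← hR']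
    have hsize : rootSize (.cons { w with won := true, base := β }
        (.cons { l with planned := true, base := min g (level s (t - 1)) } cl cw) B) =
        s + t + R' := by
      simp only [rootSize, size, hlt, hwt, Bool.and_self, if_true, ← hs, hsz, ← hR']
    have hlen : length (.cons x₁ c₁ (.cons x₂ c₂ A)) / 2 = length A / 2 + 1 := by
      simp only [length]
      omega
    have hwon : ((n + (if l.won then 1 else 0) : ℕ) : ℝ) * 80 =
        80 * n + (if l.won then 80 else 0) := by
      cases l.won <;> simp <;> ring
    have hv1 : rootVariation N (j + 1) b (.cons { w with won := true, base := β }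
        (.cons { l with planned := true, base := min g (level s (t - 1)) } cl cw) B) =
        |gauge N (j + 1) b - gauge N (j + 1) β| + rootVariation N (j + 1) β B := by
      simp [rootVariation, hwt]
    have hv2 : rootVariation N j b (.cons x₁ c₁ (.cons x₂ c₂ A)) =
        |gauge N j b - gauge N j x₁.base| + |gauge N j x₁.base - gauge N j x₂.base| +
          rootVariation N j x₂.base A := by
      simp [rootVariation, ht₁, ht₂]
      ring
    rw [hroot, hsize, hlen, hen, hv1, hv2]
    -- The threshold costs 800/4000 = 1/5 of the pass weight; the square root error adds 1/4000.
    have hthr : 800 * threshold j + passWeight j / 4000 ≤ 21 / 100 * passWeight j := by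
      unfold threshold
      linarith
    push_cast at hwon hlog ⊢
    linarith

lemma PassOutcome.nonreal_link {N j : ℕ} (hN : 0 < N) {A B : MForest} {n d : ℕ}
    (h : PassOutcome N j A B n d) {l w x₁ x₂ : Mark} {cl cw c₁ c₂ : MForest} {q : Bool}
    (hq : (q && l.temp) = false) (hqw : q = true → w.temp = true)
    (hx : (x₁ = l ∧ c₁ = cl ∧ x₂ = w ∧ c₂ = cw) ∨ (x₁ = w ∧ c₁ = cw ∧ x₂ = l ∧ c₂ = cl))
    (h₁ : x₁.temp = true → 0 ≤ x₁.base ∧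
      x₁.base ≤ level (1 + size c₁) (rootSize (.cons x₂ c₂ A)))
    (h₂ : x₂.temp = true → 0 ≤ x₂.base ∧ x₂.base ≤ level (1 + size c₂) (rootSize A)) :
    ∃ b d', (w.temp = true → 0 ≤ b ∧ b ≤ level (1 + size cw) (rootSize B)) ∧
      PassOutcome N j (.cons x₁ c₁ (.cons x₂ c₂ A)) (.cons { w with base := b }
        (.cons { l with planned := q } cl cw) B) n d' := by
  have hρ := passWeight_pos j
  have hpw : (3 * 10 ^ 19 / passWeight j : ℝ) ≥ 0 := by positivity
  have hRR := h.rootSize_le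
  have core : ∃ f₀ g₀ : ℝ, (l.temp → 0 ≤ l.base ∧ l.base ≤ f₀) ∧
      (w.temp → 0 ≤ w.base ∧ w.base ≤ g₀) ∧ level (1 + size cw) (rootSize B) ≤ g₀ ∧
      rootEnergy N (.cons x₁ c₁ (.cons x₂ c₂ A)) =
        rootNodeEnergy N l cl f₀ + rootNodeEnergy N w cw g₀ + rootEnergy N A := by
    rcases hx with ⟨rfl, rfl, rfl, rfl⟩ | ⟨rfl, rfl, rfl, rfl⟩
    · refine ⟨_, _, h₁, h₂, level_mono_right (by omega) hRR, ?_⟩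
      simp only [rootEnergy]
      ring
    · refine ⟨_, _, h₂, h₁, level_mono_right (by omega) ?_, ?_⟩
      · simp only [rootSize]
        omega
      · simp only [rootEnergy]
        ring
  obtain ⟨f₀, g₀, hl, hw, hg, hen⟩ := core
  refine ⟨min w.base (level (1 + size cw) (rootSize B)), d + (if q then 0 else 1),
    fun hwt => ⟨le_min (hw hwt).1 (level_nonneg _ _), min_le_right _ _⟩, ?_, ?_, ?_, ?_, ?_, ?_⟩
  · rcases hx with ⟨rfl, rfl, rfl, rfl⟩ | ⟨rfl, rfl, rfl, rfl⟩ <;>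
      simp only [rootSize, size, hq, Bool.false_eq_true, if_false, zero_add] <;> omega
  · have := h.length_eq
    simp only [length]
    omega
  · have := h.permanentRoots_le
    cases hqq : q
    · simp only [permanentRoots, Bool.false_eq_true, if_false]
      split_ifs <;> omega
    · simp only [permanentRoots, hqw hqq, if_true]
      omega
  · have := h.freshRoots_le
    have h0 : freshRoots (.cons { w with base := min w.base (level (1 + size cw) (rootSize B)) }
        (.cons { l with planned := q } cl cw) B) ≤ 1 + freshRoots B := by
      simp only [freshRoots]
      split_ifs <;> omega
    have h3 : permanentRoots A + (if q then 1 else 0) ≤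
        permanentRoots (.cons x₁ c₁ (.cons x₂ c₂ A)) := by
      cases hqq : q
      · simp only [permanentRoots, Bool.false_eq_true, if_false]
        omega
      · have hlt : l.temp = false := by simpa [hqq] using hq
        rcases hx with ⟨rfl, -, rfl, -⟩ | ⟨rfl, -, rfl, -⟩ <;>
          simp only [permanentRoots, hlt, Bool.false_eq_true, if_false, if_true] <;> omega
    have h4 : (if q then 1 else 0) + (if q then 0 else 1) = 1 := by cases q <;> rfl
    omega
  · have := h.links_le
    have h3 : freshRoots A + (if q then 1 else 0) ≤
        freshRoots (.cons x₁ c₁ (.cons x₂ c₂ A)) := by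
      cases hqq : q
      · simp only [freshRoots, Bool.false_eq_true, if_false]
        omega
      · have hlt : l.temp = false := by simpa [hqq] using hq
        rcases hx with ⟨rfl, -, rfl, -⟩ | ⟨rfl, -, rfl, -⟩ <;>
          simp only [freshRoots, hlt, Bool.false_and, Bool.false_eq_true, if_false, if_true] <;>
          omega
    have h4 : (if q then 1 else 0) + (if q then 0 else 1) = 1 := by cases q <;> rfl
    simp only [length] at this ⊢
    omega
  · intro b hb
    have key := nonreal_link_energy hN l w { l with planned := q } cl cw A B hl hw
      (level_nonneg (1 + size cw) (rootSize B)) hg hb hq (c₁ := c₁) (c₂ := c₂)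
      (x₁ := x₁) (x₂ := x₂) (by
        rcases hx with ⟨h1, -, h2, -⟩ | ⟨h1, -, h2, -⟩
        exacts [Or.inl ⟨h1, h2⟩, Or.inr ⟨h1, h2⟩]) h.energy_le
    set β := min w.base (level (1 + size cw) (rootSize B))
    have hroot : rootEnergy N (.cons { w with base := β }
        (.cons { l with planned := q } cl cw) B) =
        rootNodeEnergy N { w with base := β }
          (.cons { l with planned := q } cl cw) (level (1 + size cw) (rootSize B)) +
        rootEnergy N B := by
      simp only [rootEnergy, size, hq, Bool.false_eq_true, if_false, zero_add]
    have hlog : Real.log (rootSize B) ≤ Real.log (rootSize (.cons { w with base := β }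
        (.cons { l with planned := q } cl cw) B)) := by
      refine log_cast_mono ?_
      simp only [rootSize]
      omega
    have hlog' := mul_le_mul_of_nonneg_left hlog hpw
    have hlen : length (.cons x₁ c₁ (.cons x₂ c₂ A)) / 2 = length A / 2 + 1 := by
      simp only [length]
      omega
    have hd : ((d + (if q then 0 else 1) : ℕ) : ℝ) * 200 = 200 * d + (if q then 0 else 200) := by
      cases q <;> simp <;> ring
    rw [hroot, hen, hlen]
    push_cast at hd ⊢
    linarith

/-- The induction treats the pairs from right to left, since the level of a root depends only on its
own subtree and on what lies to its right. -/
lemma PairingPass.exists_outcome {α κ : Type*} [LinearOrder κ] (T fl : α → Bool) {N j : ℕ}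
    (hj : j < N) {F G : Forest α κ} {t : ℕ} (hp : PairingPass F G t) :
    ∀ A, RepresentsRoots T fl F A → ∃ B n d, RepresentsRoots T fl G B ∧
      PassOutcome N j A B n d ∧ t = length A := by
  have hN : 0 < N := by omega
  have hρ := passWeight_pos j
  induction hp with
  | nil =>
    intro A hA
    obtain rfl := hA.eq_nil
    exact ⟨.nil, 0, 0, trivial, ⟨le_rfl, rfl, by simp [permanentRoots], by simp [freshRoots],
      by simp [length], fun b _ => by simp [rootEnergy, rootVariation, length, rootSize]⟩, rfl⟩
  | single e k c =>
    intro A hA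
    obtain ⟨x, c', r', rfl, h1, h2, h3, h4⟩ := hA.exists_cons
    obtain rfl := h4.eq_nil
    refine ⟨.cons x c' .nil, 0, 0, ⟨h1, h2, h3, trivial⟩,
      ⟨le_rfl, by simp [length], ?_, ?_, by simp [length], ?_⟩, by simp [length]⟩
    · simp only [permanentRoots]
      split_ifs <;> omega
    · simp only [freshRoots]
      split_ifs <;> omega
    · intro b _
      have e1 := MForest.rootVariation_succ_le N j b (.cons x c' .nil)
      have e2 : 0 ≤ (3 * 10 ^ 19 / passWeight j : ℝ) *
          Real.log (rootSize (.cons x c' .nil)) :=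
        mul_nonneg (by positivity) (log_cast_nonneg _)
      have e3 : length (.cons x c' .nil) / 2 = 0 := by simp [length]
      rw [e3]
      push_cast
      linarith
  | pair e f g k l m c d b r r' t hlink hrest ih =>
    intro A hA
    obtain ⟨x₁, c₁, A, rfl, ht₁, hb₁, hc₁, hA⟩ := hA.exists_cons
    obtain ⟨x₂, c₂, A, rfl, ht₂, hb₂, hc₂, hA⟩ := hA.exists_cons
    obtain ⟨B, n, δ, hB, hout, rfl⟩ := ih A hA
    have hlen : length A + 2 = length (.cons x₁ c₁ (.cons x₂ c₂ A)) := by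
      simp only [length]
      omega
    cases hlink with
    | left_wins _ _ _ _ _ _ h =>
      by_cases hreal : T e = true ∧ T f = true ∧ fl f = true
      · obtain ⟨hTe, hTf, hfl⟩ := hreal
        obtain ⟨a, b, n', ha0, ha, hb0, hb, ho⟩ := hout.real_link hN hj (ht₂.trans hTf)
          (ht₁.trans hTe) (Or.inr ⟨rfl, rfl, rfl, rfl⟩) hb₁ hb₂
        refine ⟨.cons { x₁ with won := true, base := b }
          (.cons { x₂ with planned := true, base := a } c₂ c₁) B, n', δ,
          ⟨ht₁, ?_, ⟨ht₂, by simp [hTe, hfl], fun _ => ⟨ha0, ha⟩, hc₂, hc₁⟩, hB⟩, ho, hlen⟩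
        simpa [size, ht₂, hTf] using fun _ => And.intro hb0 hb
      · have hq : ((fl f && T e) && x₂.temp) = false := by
          rw [ht₂]
          cases h1 : T e <;> cases h2 : T f <;> cases h3 : fl f <;> simp_all
        obtain ⟨b, d', hb, ho⟩ := hout.nonreal_link hN (q := fl f && T e) hq
          (fun h => by rw [ht₁]; simp_all) (Or.inr ⟨rfl, rfl, rfl, rfl⟩) hb₁ hb₂
        refine ⟨.cons { x₁ with base := b } (.cons { x₂ with planned := fl f && T e } c₂ c₁) B,
          n, d', ⟨ht₁, ?_, ⟨ht₂, rfl, fun h => ?_, hc₂, hc₁⟩, hB⟩, ho, hlen⟩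
        · simpa [size, hq] using hb
        · exact absurd h (by simp only [hq]; simp)
    | right_wins _ _ _ _ _ _ h =>
      by_cases hreal : T f = true ∧ T e = true ∧ fl e = true
      · obtain ⟨hTe, hTf, hfl⟩ := hreal
        obtain ⟨a, b, n', ha0, ha, hb0, hb, ho⟩ := hout.real_link hN hj (ht₁.trans hTf)
          (ht₂.trans hTe) (Or.inl ⟨rfl, rfl, rfl, rfl⟩) hb₁ hb₂
        refine ⟨.cons { x₂ with won := true, base := b }
          (.cons { x₁ with planned := true, base := a } c₁ c₂) B, n', δ,
          ⟨ht₂, ?_, ⟨ht₁, by simp [hTe, hfl], fun _ => ⟨ha0, ha⟩, hc₁, hc₂⟩, hB⟩, ho, hlen⟩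
        simpa [size, ht₁, hTf] using fun _ => And.intro hb0 hb
      · have hq : ((fl e && T f) && x₁.temp) = false := by
          rw [ht₁]
          cases h1 : T f <;> cases h2 : T e <;> cases h3 : fl e <;> simp_all
        obtain ⟨b, d', hb, ho⟩ := hout.nonreal_link hN (q := fl e && T f) hq
          (fun h => by rw [ht₂]; simp_all) (Or.inl ⟨rfl, rfl, rfl, rfl⟩) hb₁ hb₂
        refine ⟨.cons { x₂ with base := b } (.cons { x₁ with planned := fl e && T f } c₁ c₂) B,
          n, d', ⟨ht₂, ?_, ⟨ht₁, rfl, fun h => ?_, hc₁, hc₂⟩, hB⟩, ho, hlen⟩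
        · simpa [size, hq] using hb
        · exact absurd h (by simp only [hq]; simp)

/-! ### Repeated pairing passes -/

/-- A lower bound for the decrease of the energy during at most three pairing passes. -/
noncomputable def passGain : ℕ → MForest → ℝ
  | 0, _ => 0
  | 1, A => 80 * (((length A / 2 : ℕ) : ℝ) - freshRoots A)
  | 2, A => 80 * ((((length A + 1) / 2 / 2 : ℕ) : ℝ) - permanentRoots A - 1)
  | _, A => 80 * (((((length A + 1) / 2 + 1) / 2 / 2 : ℕ) : ℝ) - 2)

lemma passGain_le_of_length_le_one (i : ℕ) {A : MForest} (h : length A ≤ 1) :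
    passGain i A ≤ 0 := by
  match i with
  | 0 => exact le_rfl
  | 1 =>
    have : length A / 2 = 0 := by omega
    simp [passGain, this]
  | 2 =>
    have : (length A + 1) / 2 / 2 = 0 := by omega
    simp only [passGain, this]
    push_cast
    have : (0 : ℝ) ≤ permanentRoots A := by positivity
    linarith
  | i + 3 =>
    have : ((length A + 1) / 2 + 1) / 2 / 2 = 0 := by omega
    simp only [passGain, this]
    norm_num

/-- A permanent winner needs an unplanned link, so after one pass the permanent roots are bounded by
the unplanned links, plus one unpaired root. In the next pass a fresh winner comes from an unplanned
link or from a pair with a permanent root. In the third pass each pair has an unplanned link, a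
fresh root, or an earlier winner that loses. Hence at least about the number of links of the third
pass is gained, in units of 80. -/
lemma PassOutcome.passGain_le {N j : ℕ} {A B : MForest} {n d : ℕ} (h : PassOutcome N j A B n d)
    (i : ℕ) (hi : i ≤ 3) :
    passGain i A ≤ passGain (i - 1) B + (80 * n + 200 * d) := by
  have hn : (0 : ℝ) ≤ n := by positivity
  have hd : (0 : ℝ) ≤ d := by positivity
  match i with
  | 0 =>
    simp only [passGain]
    linarith
  | 1 =>
    have h1 : ((length A / 2 : ℕ) : ℝ) ≤ n + d + freshRoots A := by exact_mod_cast h.links_le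
    simp only [passGain]
    linarith
  | 2 =>
    have h1 : (freshRoots B : ℝ) ≤ d + permanentRoots A + 1 := by exact_mod_cast h.freshRoots_le
    simp only [passGain, h.length_eq]
    linarith
  | 3 =>
    have h1 : (permanentRoots B : ℝ) ≤ d + 1 := by exact_mod_cast h.permanentRoots_le
    simp only [passGain, h.length_eq]
    linarith
  | i + 4 => omega

/-- The parameter i counts the passes whose gain is still used; later gains are discarded. The error
terms are geometric: the linear one shrinks by 3/2·1/2 per pass (21/25 = 21/100 + 3/4·21/25), the
logarithmic one by 2/3 (9 = 3 + 2/3·9). The hypothesis j + t ≤ N keeps all pass indices below N,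
since every pass takes a step. -/
lemma Multipass.exists_outcome {α κ : Type*} [LinearOrder κ] (T fl : α → Bool) {N : ℕ}
    {F G : Forest α κ} {t : ℕ} (hm : Multipass F G t) :
    ∀ (i j : ℕ) (A : MForest), i ≤ 3 → j + t ≤ N → RepresentsRoots T fl F A →
      ∃ B, RepresentsRoots T fl G B ∧ t ≤ 4 * length A + 1 ∧
        rootEnergy N B + passGain i A ≤ rootEnergy N A + 800 * rootVariation N j 0 A +
          (21 / 25 * passWeight j * ((length A - 1 : ℕ) : ℝ) +
            9 * 10 ^ 19 / passWeight j * Real.log (rootSize A)) := by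
  have base : ∀ (i j : ℕ) (A : MForest), length A ≤ 1 →
      rootEnergy N A + passGain i A ≤ rootEnergy N A + 800 * rootVariation N j 0 A +
          (21 / 25 * passWeight j * ((length A - 1 : ℕ) : ℝ) +
            9 * 10 ^ 19 / passWeight j * Real.log (rootSize A)) := by
    intro i j A hA
    have h1 := passGain_le_of_length_le_one i hA
    have h2 := MForest.rootVariation_nonneg N j 0 A
    have h3 := passWeight_pos j
    have h4 : 0 ≤ 9 * 10 ^ 19 / passWeight j * Real.log (rootSize A) :=
      mul_nonneg (by positivity) (log_cast_nonneg _)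
    have h5 : 0 ≤ 21 / 25 * passWeight j * ((length A - 1 : ℕ) : ℝ) := by positivity
    linarith
  induction hm with
  | nil =>
    intro i j A _ _ hA
    obtain rfl := hA.eq_nil
    exact ⟨.nil, trivial, by omega, base i j _ (by simp [length])⟩
  | single e k c =>
    intro i j A _ _ hA
    have hlen : length A ≤ 1 := by
      obtain ⟨x, c', r', rfl, -, -, -, h4⟩ := hA.exists_cons
      obtain rfl := h4.eq_nil
      simp [length]
    exact ⟨A, hA, by omega, base i j A hlen⟩
  | pass e f k l c d r F G s t hpass hrest ih =>
    intro i j A hi hj hA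
    have hlen : 2 ≤ length A := by
      obtain ⟨x, c', r', rfl, -, -, -, h4⟩ := hA.exists_cons
      obtain ⟨x, c', r', rfl, -, -, -, -⟩ := h4.exists_cons
      simp only [length]
      omega
    obtain ⟨B, n, d, hB, hout, rfl⟩ := hpass.exists_outcome T fl (show j < N by omega) A hA
    obtain ⟨D, hD, ht, hen⟩ := ih (i - 1) (j + 1) B (by omega) (by omega) hB
    have hl := hout.length_eq
    refine ⟨D, hD, by omega, ?_⟩
    have h1 := hout.energy_le 0 le_rfl
    have h2 := hout.passGain_le i hi
    have hρ := passWeight_pos j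
    have h3 : Real.log (rootSize B) ≤ Real.log (rootSize A) := log_cast_mono hout.rootSize_le
    have h4 : (((length A / 2 : ℕ) : ℝ)) ≤ ((length A - 1 : ℕ) : ℝ) := by
      exact_mod_cast (by omega : length A / 2 ≤ length A - 1)
    have h5 : 2 * ((length B - 1 : ℕ) : ℝ) ≤ ((length A - 1 : ℕ) : ℝ) := by
      exact_mod_cast (by omega : 2 * (length B - 1) ≤ length A - 1)
    have e1 : 9 * 10 ^ 19 / passWeight (j + 1) = 6 * 10 ^ 19 / passWeight j := by
      rw [passWeight_succ]
      field_simp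
      norm_num
    rw [e1, passWeight_succ] at hen
    have e2 := mul_le_mul_of_nonneg_right h4 (show 0 ≤ 21 / 100 * passWeight j by positivity)
    have e3 := mul_le_mul_of_nonneg_left h5 (show 0 ≤ 63 / 100 * passWeight j by positivity)
    have e4 := mul_le_mul_of_nonneg_left h3 (show 0 ≤ 9 * 10 ^ 19 / passWeight j by positivity)
    have e5 : 9 * 10 ^ 19 / passWeight j * Real.log (rootSize B) =
      3 * 10 ^ 19 / passWeight j * Real.log (rootSize B) +
        6 * 10 ^ 19 / passWeight j * Real.log (rootSize B) := by ring
    linarith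

/-! ### Deletion of the root -/

/-- A list of children as a list of roots that have not won a link yet. -/
def MForest.promote : MForest → MForest
  | .nil => .nil
  | .cons x c r => .cons { x with won := false } c (promote r)

/-- All children in the list have planned links. -/
def MForest.AllPlanned : MForest → Prop
  | .nil => True
  | .cons x _ r => x.planned = true ∧ AllPlanned r

/-- An upper bound for the number of low roots in a list of total size `n`. -/
noncomputable def lowBound (n : ℕ) : ℝ := if n = 0 then 0 else 1 + Real.exp 11 * Real.log n

/-- A level below 1 means (s+R)/s ≤ exp(4·exp 1) ≤ exp 11. Such a root raises the logarithm of the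
accumulated size by at least s/(s+R) ≥ exp(-11), so low roots are counted by exp 11 times a
logarithm. The rightmost root, with nothing on its right, accounts for the additive 1. -/
lemma low_add_lowBound_le {s : ℕ} (R : ℕ) (hs : 0 < s) :
    1 - min (level s R) 1 + lowBound R ≤ lowBound (s + R) := by
  have h0 := level_nonneg s R
  have hlow : 1 - min (level s R) 1 ≤ 1 := by linarith [le_min h0 zero_le_one]
  have hs1 : (0 : ℝ) < s := by exact_mod_cast hs
  rcases Nat.eq_zero_or_pos R with rfl | hR
  · have : 0 ≤ Real.exp 11 * Real.log ((s + 0 : ℕ) : ℝ) :=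
      mul_nonneg (by positivity) (log_cast_nonneg _)
    rw [lowBound, lowBound, if_pos rfl, if_neg (by omega)]
    linarith
  · have hR1 : (0 : ℝ) < R := by exact_mod_cast hR
    rw [lowBound, lowBound, if_neg (by omega), if_neg (by omega)]
    have hlog : Real.log R ≤ Real.log ((s + R : ℕ) : ℝ) := log_cast_mono (by omega)
    rcases le_total 1 (level s R) with h | h
    · rw [min_eq_right h]
      have := mul_le_mul_of_nonneg_left hlog (Real.exp_pos 11).le
      linarith
    · have hd : Real.log ((s + R : ℝ) / s) ≤ 11 := by
        unfold level logLevel at h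
        rw [Real.log_le_iff_le_exp (lt_of_lt_of_le one_pos (le_max_left _ _))] at h
        have h1 := (le_max_right _ _).trans h
        have h2 := Real.exp_one_lt_d9
        linarith
      have h1 : (s + R : ℝ) ≤ Real.exp 11 * s := by
        rwa [Real.log_le_iff_le_exp (by positivity), div_le_iff₀ hs1] at hd
      have h2 : (s : ℝ) / (s + R) ≤ Real.log ((s + R : ℕ) : ℝ) - Real.log R := by
        have h3 := Real.one_sub_inv_le_log_of_pos (show (0 : ℝ) < (s + R) / R by positivity)
        rw [Real.log_div (by positivity) (by positivity)] at h3
        have h4 : 1 - ((s + R : ℝ) / R)⁻¹ = s / (s + R) := by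
          field_simp
          ring
        push_cast
        linarith
      have h3 : 1 ≤ Real.exp 11 * (s / (s + R)) := by
        rw [← mul_div_assoc, le_div_iff₀ (by positivity)]
        linarith
      have h4 := mul_le_mul_of_nonneg_left h2 (Real.exp_pos 11).le
      linarith

lemma rootSize_promote : ∀ {C : MForest}, C.AllPlanned → rootSize C.promote = size C
  | .nil, _ => rfl
  | .cons x c r, h => by
    simp only [MForest.promote, rootSize, size, h.1, rootSize_promote h.2, Bool.true_and]

lemma length_promote : ∀ C : MForest, length C.promote = length C
  | .nil => rfl
  | .cons x c r => by simp only [MForest.promote, length, length_promote r]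

/-- Child and root energies are designed to match: the 200 units of a planned link become those of a
root, and the gauged variation becomes the root variation of index 0. Only the charge for low roots
is new. -/
lemma rootEnergy_promote_le (N : ℕ) : ∀ (b : ℝ) (C : MForest), C.AllPlanned →
    rootEnergy N C.promote + 800 * rootVariation N 0 b C.promote ≤
      energy N C + 800 * variation N (gauge N 0 b) C + 200 * lowBound (size C)
  | b, .nil, _ => by simp [MForest.promote, rootEnergy, rootVariation, energy, variation, size,
      lowBound]
  | b, .cons x c r, h => by
    have hp := h.1
    have hsz := rootSize_promote h.2
    simp only [MForest.promote, rootEnergy, rootNodeEnergy, rootVariation, energy, variation, size,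
      hp, hsz, Bool.true_and, if_true]
    cases ht : x.temp
    · have ih := rootEnergy_promote_le N b r h.2
      simp only [Bool.false_eq_true, if_false, zero_add]
      linarith
    · have ih := rootEnergy_promote_le N x.base r h.2
      have hl := low_add_lowBound_le (s := 1 + size c) (size r) (by omega)
      simp only [if_true, rootTerm, Bool.false_eq_true, if_false]
      linarith

/-! ### The items of a forest -/

lemma Link.items_perm {α κ : Type*} [LinearOrder κ] {F G W : Forest α κ} (h : Link F G W) :
    W.items.Perm (F.items ++ G.items) := by
  cases h with
  | left_wins e f k l c d h =>
    simp only [items, List.append_nil]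
    refine List.Perm.cons e ?_
    exact (List.perm_append_comm : ((f :: items d) ++ items c).Perm _)
  | right_wins e f k l c d h =>
    simp only [items, List.append_nil]
    exact (List.perm_middle (l₁ := e :: items c)).symm

lemma Cut.items_perm {α κ : Type*} {e : α} {F F' d : Forest α κ} {k : κ} (h : Cut e F k d F') :
    F.items.Perm ((e :: items d) ++ F'.items) := by
  induction h with
  | here k d r => exact List.Perm.refl _
  | inside f l c c' r k d h ih =>
    simp only [items]
    refine ((ih.append_right (items r)).cons f).trans ?_
    rw [List.append_assoc]
    exact List.perm_middle.symm
  | later f l c r r' k d h ih =>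
    simp only [items]
    refine ((ih.append_left (items c)).cons f).trans ?_
    rw [← List.append_assoc]
    refine ((List.perm_append_comm.append_right _).cons f).trans ?_
    rw [List.append_assoc]
    exact List.perm_middle.symm

lemma Join.items_perm {α κ : Type*} [LinearOrder κ] {F G W : Forest α κ} {t : ℕ}
    (h : Join F G W t) : W.items.Perm (F.items ++ G.items) := by
  cases h with
  | nil_left => simp [items]
  | nil_right => simp [items]
  | link _ _ _ h => exact h.items_perm

lemma PairingPass.items_perm {α κ : Type*} [LinearOrder κ] {F G : Forest α κ} {t : ℕ}
    (h : PairingPass F G t) : G.items.Perm F.items := by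
  induction h with
  | nil => exact List.Perm.refl _
  | single => exact List.Perm.refl _
  | pair e f g k l m c d b r r' t hlink hrest ih =>
    have h1 := hlink.items_perm
    simp only [items, List.append_nil] at h1 ⊢
    have h2 := h1.append ih
    simpa using h2

lemma Multipass.items_perm {α κ : Type*} [LinearOrder κ] {F G : Forest α κ} {t : ℕ}
    (h : Multipass F G t) : G.items.Perm F.items := by
  induction h with
  | nil => exact List.Perm.refl _
  | single => exact List.Perm.refl _
  | pass e f k l c d r F G s t hpass hrest ih => exact ih.trans hpass.items_perm

lemma DecreaseKey.items_perm {α κ : Type*} [LinearOrder κ] {e : α} {k' : κ} {F G : Forest α κ}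
    {t : ℕ} (h : DecreaseKey e k' F G t) : G.items.Perm F.items := by
  cases h with
  | root => exact List.Perm.refl _
  | nonroot f l c c' k d G hcut hk hlink =>
    have h1 := hlink.items_perm
    have h2 := hcut.items_perm
    simp only [items, List.append_nil] at h1 ⊢
    refine h1.trans ?_
    exact (List.perm_middle (l₁ := e :: items d)).trans (h2.symm.cons f)

/-- The items at the roots of a forest. -/
def Forest.rootItems {α κ : Type*} : Forest α κ → List α
  | nil => []
  | cons e _ _ r => e :: rootItems r

/-- The items of a forest that are not at its roots. -/
def Forest.innerItems {α κ : Type*} : Forest α κ → List α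
  | nil => []
  | cons _ _ c r => items c ++ innerItems r

lemma items_perm_rootItems_append {α κ : Type*} : ∀ F : Forest α κ,
    F.items.Perm (F.rootItems ++ F.innerItems)
  | .nil => List.Perm.refl _
  | .cons e _ c r => by
    simp only [items, rootItems, innerItems, List.cons_append]
    refine List.Perm.cons e ?_
    refine ((items_perm_rootItems_append r).append_left _).trans ?_
    rw [← List.append_assoc, ← List.append_assoc]
    exact List.perm_append_comm.append_right _

/-! ### Dependence of the marks on the items -/

lemma Represents.congr {α κ : Type*} {T T' fl fl' : α → Bool} : ∀ {p : Bool} {F : Forest α κ}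
    {A : MForest}, (∀ x ∈ F.items, T x = T' x ∧ fl x = fl' x) → Represents T fl p F A →
    Represents T' fl' p F A
  | _, .nil, _, _, h => by
    obtain rfl := h.eq_nil
    trivial
  | p, .cons e _ c r, _, hx, h => by
    obtain ⟨x, c', r', rfl, h1, h2, h3, h4, h5⟩ := h.exists_cons
    simp only [items, List.mem_cons, List.mem_append] at hx
    obtain ⟨e1, e2⟩ := hx e (Or.inl rfl)
    refine ⟨h1.trans e1, by rw [h2, e2], h3, ?_, ?_⟩
    · rw [← e1]
      exact Represents.congr (fun x hxc => hx x (Or.inr (Or.inl hxc))) h4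
    · exact Represents.congr (fun x hxr => hx x (Or.inr (Or.inr hxr))) h5

lemma RepresentsRoots.congr {α κ : Type*} {T T' fl fl' : α → Bool} : ∀ {F : Forest α κ}
    {A : MForest}, (∀ x ∈ F.items, T x = T' x ∧ fl x = fl' x) → RepresentsRoots T fl F A →
    RepresentsRoots T' fl' F A
  | .nil, _, _, h => by
    obtain rfl := h.eq_nil
    trivial
  | .cons e _ c r, _, hx, h => by
    obtain ⟨x, c', r', rfl, h1, h2, h3, h4⟩ := h.exists_cons
    simp only [items, List.mem_cons, List.mem_append] at hx
    obtain ⟨e1, -⟩ := hx e (Or.inl rfl)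
    refine ⟨h1.trans e1, h2, ?_, ?_⟩
    · rw [← e1]
      exact h3.congr fun x hxc => hx x (Or.inr (Or.inl hxc))
    · exact RepresentsRoots.congr (fun x hxr => hx x (Or.inr (Or.inr hxr))) h4

lemma Represents.size_le {α κ : Type*} {T fl : α → Bool} : ∀ {p : Bool} {F : Forest α κ}
    {A : MForest}, Represents T fl p F A → size A ≤ F.items.countP T
  | _, .nil, _, h => by
    obtain rfl := h.eq_nil
    simp [size]
  | p, .cons e _ c r, _, h => by
    obtain ⟨x, c', r', rfl, h1, h2, h3, h4, h5⟩ := h.exists_cons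
    have i1 := h4.size_le
    have i2 := h5.size_le
    simp only [size, items, List.countP_cons, List.countP_append, h1]
    cases x.planned <;> cases T e <;> simp <;> omega

lemma RepresentsRoots.promote {α κ : Type*} {T fl fl' : α → Bool} : ∀ {F : Forest α κ}
    {A : MForest}, (∀ x ∈ F.rootItems, fl x = true) → (∀ x ∈ F.innerItems, fl x = fl' x) →
    Represents T fl true F A → A.AllPlanned ∧ RepresentsRoots T fl' F A.promote
  | .nil, _, _, _, h => by
    obtain rfl := h.eq_nil
    exact ⟨trivial, trivial⟩
  | .cons e _ c r, _, hr, hi, h => by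
    obtain ⟨x, c', r', rfl, h1, h2, h3, h4, h5⟩ := h.exists_cons
    simp only [rootItems, innerItems, List.mem_cons, List.mem_append] at hr hi
    obtain ⟨i1, i2⟩ := RepresentsRoots.promote (fun x hx => hr x (Or.inr hx))
      (fun x hx => hi x (Or.inr hx)) h5
    have hp : x.planned = true := by rw [h2, hr e (Or.inl rfl)]; rfl
    refine ⟨⟨hp, i1⟩, h1, fun ht => ?_, h4.congr fun x hx => ⟨rfl, hi x (Or.inl hx)⟩, i2⟩
    rw [rootSize_promote i1]
    exact h3 (by rw [hp]; exact ht)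

/-! ### Operations on the root of a heap -/

/-- The energy of a heap whose root has the list `C` of children and is temporary if `p` is
true. -/
noncomputable def treeEnergy (N : ℕ) (p : Bool) (C : MForest) : ℝ :=
  200 + (if p then 200 else 0) + 800 * variation N 0 C + energy N C

lemma rootEnergy_cons_nil {N : ℕ} {x : Mark} {C : MForest}
    (h : x.temp = true → 0 ≤ x.base ∧ x.base ≤ level (1 + size C) 0) :
    rootEnergy N (.cons x C .nil) = treeEnergy N x.temp C := by
  have hl := level_zero_right (s := 1 + size C) (by omega)
  rw [hl] at h
  simp only [rootEnergy, rootSize, hl, rootNodeEnergy, treeEnergy, rootTerm, gauge_zero]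
  cases ht : x.temp
  · simp
  · have : x.base = 0 := le_antisymm (h ht).2 (h ht).1
    simp [this]
    ring

lemma RepresentsRoots.exists_tree {α κ : Type*} {T fl : α → Bool} {e : α} {k : κ}
    {c : Forest α κ} {A : MForest} (h : RepresentsRoots T fl (tree e k c) A) :
    ∃ C, Represents T fl (T e) c C ∧ ∀ N, rootEnergy N A = treeEnergy N (T e) C := by
  obtain ⟨x, c', r', rfl, h1, h2, h3, h4⟩ := h.exists_cons
  obtain rfl := h4.eq_nil
  exact ⟨c', h3, fun N => by rw [rootEnergy_cons_nil h2, h1]⟩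

lemma Represents.exists_tree {α κ : Type*} {T fl : α → Bool} {e : α} {c : Forest α κ}
    {C : MForest} (h : Represents T fl (T e) c C) (k : κ) :
    ∃ A, RepresentsRoots T fl (tree e k c) A ∧ ∀ N, rootEnergy N A = treeEnergy N (T e) C := by
  have hb : T e = true → (0 : ℝ) ≤ 0 ∧ 0 ≤ level (1 + size C) 0 :=
    fun _ => ⟨le_rfl, level_nonneg _ _⟩
  exact ⟨.cons ⟨T e, false, false, 0⟩ C .nil, ⟨rfl, hb, h, trivial⟩,
    fun N => rootEnergy_cons_nil hb⟩

/-- Outside deletions the new child gets base 0, which adds no variation in front of its siblings. A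
new real link thus costs 6400 for its gauge and 800 for the variation among its own children. -/
lemma Represents.exists_link {α κ : Type*} {T fl : α → Bool} {e f : α} {c d : Forest α κ}
    {C D : MForest} (hC : Represents T fl (T e) c C) (hD : Represents T fl (T f) d D)
    (N : ℕ) (k l : κ) :
    ∃ A, RepresentsRoots T fl (tree e k (cons f l d c)) A ∧
      rootEnergy N A ≤ treeEnergy N (T e) C + treeEnergy N (T f) D +
        if T e && T f then 7200 * gauge N 0 (level (1 + size D) (size C)) else 0 := by
  obtain ⟨A, hA, hen⟩ := Represents.exists_tree (e := e) (fl := fl) (c := cons f l d c)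
    (C := .cons ⟨T f, fl f && T e, false, 0⟩ D C)
    ⟨rfl, rfl, fun _ => ⟨le_rfl, level_nonneg _ _⟩, hD, hC⟩ k
  refine ⟨A, hA, ?_⟩
  rw [hen]
  have h1 := gauge_nonneg N 0 (level (1 + size D) (size C))
  have h2 := MForest.variation_le N (gauge N 0 (level (1 + size D) (size C))) 0 D
  rw [sub_zero, abs_of_nonneg h1] at h2
  simp only [treeEnergy, variation, energy, gauge_zero, sub_zero, abs_zero]
  cases T e <;> cases T f <;> cases fl f <;> simp <;> linarith

lemma Link.exists_outcome {α κ : Type*} [LinearOrder κ] {T fl : α → Bool} {e f : α} {k l : κ}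
    {c d W : Forest α κ} (h : Link (tree e k c) (tree f l d) W) {C D : MForest}
    (hC : Represents T fl (T e) c C) (hD : Represents T fl (T f) d D) (N : ℕ) :
    ∃ A, RepresentsRoots T fl W A ∧
      rootEnergy N A ≤ treeEnergy N (T e) C + treeEnergy N (T f) D +
        if T e && T f then 7200 * gauge N 0 (logLevel (Real.log (W.items.countP T))) else 0 := by
  have hp := h.items_perm.countP_eq T
  have hC' := hC.size_le
  have hD' := hD.size_le
  simp only [items, List.append_nil, List.cons_append, List.countP_cons, List.countP_append] at hp
  cases h with
  | left_wins _ _ _ _ _ _ h =>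
    obtain ⟨A, hA, hen⟩ := hC.exists_link hD N k l
    refine ⟨A, hA, hen.trans ?_⟩
    cases h1 : T e <;> cases h2 : T f <;> simp
    refine gauge_mono N 0 (level_le_logLevel_log (by omega) ?_)
    simp [h1, h2] at hp ⊢
    omega
  | right_wins _ _ _ _ _ _ h =>
    obtain ⟨A, hA, hen⟩ := hD.exists_link hC N l k
    refine ⟨A, hA, hen.trans ?_⟩
    rw [add_comm (treeEnergy N (T f) D)]
    cases h1 : T e <;> cases h2 : T f <;> simp
    refine gauge_mono N 0 (level_le_logLevel_log (by omega) ?_)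
    simp [h1, h2] at hp ⊢
    omega

/-- An unplanned node is invisible to sizes and variations and contributes a separate summand to the
energy, so removing it leaves all ancestors and siblings untouched. -/
lemma Cut.exists_outcome {α κ : Type*} {T fl : α → Bool} {e : α} {c d c' : Forest α κ} {k : κ}
    (h : Cut e c k d c') (he : fl e = false) (N : ℕ) :
    ∀ {p : Bool} {C : MForest}, Represents T fl p c C →
      ∃ C' D, Represents T fl p c' C' ∧ Represents T fl (T e) d D ∧ size C' = size C ∧
        (∀ b, variation N b C' = variation N b C) ∧
        energy N C = energy N C' + (800 * variation N 0 D + energy N D) := by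
  induction h with
  | here k d r =>
    intro p C hC
    obtain ⟨x, D, C', rfl, h1, h2, h3, h4, h5⟩ := hC.exists_cons
    have hp : x.planned = false := by simp [h2, he]
    exact ⟨C', D, h5, h4, by simp [size, hp], fun b => by simp [variation, hp], by
      simp [energy, hp]; ring⟩
  | inside f l c c' r k d h ih =>
    intro p C hC
    obtain ⟨x, c₁, r₁, rfl, h1, h2, h3, h4, h5⟩ := hC.exists_cons
    obtain ⟨C', D, i1, i2, i3, i4, i5⟩ := ih h4
    refine ⟨.cons x C' r₁, D, ⟨h1, h2, by rw [i3]; exact h3, i1, h5⟩, i2, by simp [size, i3],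
      fun b => by simp [variation], ?_⟩
    simp only [energy, i3, i4, i5]
    ring
  | later f l c r r' k d h ih =>
    intro p C hC
    obtain ⟨x, c₁, r₁, rfl, h1, h2, h3, h4, h5⟩ := hC.exists_cons
    obtain ⟨C', D, i1, i2, i3, i4, i5⟩ := ih h5
    refine ⟨.cons x c₁ C', D, ⟨h1, h2, by rw [i3]; exact h3, h4, i1⟩, i2, by simp [size, i3],
      fun b => by simp [variation, i4], ?_⟩
    simp only [energy, i3, i5]
    ring

lemma DecreaseKey.exists_outcome {α κ : Type*} [LinearOrder κ] {e : α} {k' : κ}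
    {F G : Forest α κ} {t : ℕ} (h : DecreaseKey e k' F G t) (hF : F.items.Nodup)
    (T fl' : α → Bool) (N : ℕ) :
    ∃ fl : α → Bool, (∀ x, x ∉ F.items → fl x = fl' x) ∧ ∀ A, RepresentsRoots T fl F A →
      ∃ B, RepresentsRoots T fl' G B ∧ rootEnergy N B + t ≤ rootEnergy N A +
        (405 + 7200 * gauge N 0 (logLevel (Real.log (F.items.countP T)))) := by
  classical
  have hperm := h.items_perm
  rw [← hperm.countP_eq T]
  have hg := gauge_nonneg N 0 (logLevel (Real.log (G.items.countP T)))
  cases h with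
  | root k c hk =>
    refine ⟨fl', fun _ _ => rfl, fun A hA => ?_⟩
    obtain ⟨C, hC, hen⟩ := hA.exists_tree
    obtain ⟨B, hB, hen'⟩ := hC.exists_tree k'
    refine ⟨B, hB, ?_⟩
    rw [hen, hen']
    push_cast
    linarith
  | nonroot f l c c' k d G hcut hk hlink =>
    have hcp := hcut.items_perm
    simp only [items, List.append_nil, List.nodup_cons] at hF
    have hnd := hcp.nodup_iff.1 hF.2
    rw [List.cons_append, List.nodup_cons, List.mem_append, not_or] at hnd
    -- The next cut of e is this decrease-key, hence not a deletion of its parent; all other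
    -- predictions are those valid afterwards.
    refine ⟨Function.update fl' e false, fun x hx => ?_, fun A hA => ?_⟩
    · refine Function.update_of_ne ?_ _ _
      rintro rfl
      apply hx
      simp only [items, List.append_nil, List.mem_cons]
      exact Or.inr (hcp.mem_iff.2 (by simp))
    · obtain ⟨C, hC, hen⟩ := hA.exists_tree
      obtain ⟨C', D, h1, h2, -, h4, h5⟩ := hcut.exists_outcome (Function.update_self e false fl')
        N hC
      have hcongr : ∀ x, x ≠ e → T x = T x ∧ Function.update fl' e false x = fl' x :=
        fun x hx => ⟨rfl, Function.update_of_ne hx _ _⟩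
      replace h1 := h1.congr fun x hx => hcongr x fun h => hnd.1.2 (h ▸ hx)
      replace h2 := h2.congr fun x hx => hcongr x fun h => hnd.1.1 (h ▸ hx)
      obtain ⟨B, hB, henB⟩ := hlink.exists_outcome h2 h1 N
      refine ⟨B, hB, ?_⟩
      rw [hen]
      have hgen : (if (T e && T f) = true then
          7200 * gauge N 0 (logLevel (Real.log (G.items.countP T))) else 0) ≤
          7200 * gauge N 0 (logLevel (Real.log (G.items.countP T))) := by
        split_ifs <;> linarith
      have hte : (if T e = true then 200 else 0 : ℝ) ≤ 200 := by split_ifs <;> norm_num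
      simp only [treeEnergy, h4] at henB ⊢
      push_cast
      linarith

lemma lowBound_le {m n : ℕ} (h : m ≤ n) : lowBound m ≤ 1 + 177147 * Real.log n := by
  have h1 : Real.exp 11 ≤ 177147 := by
    have e1 : Real.exp 11 = Real.exp 1 ^ 11 := by rw [← Real.exp_nat_mul]; norm_num
    rw [e1, show (177147 : ℝ) = 3 ^ 11 by norm_num]
    exact pow_le_pow_left₀ (Real.exp_pos 1).le (by linarith [Real.exp_one_lt_d9]) 11
  have h2 := mul_le_mul h1 (log_cast_mono h) (log_cast_nonneg m) (by norm_num)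
  unfold lowBound
  split_ifs
  · linarith [log_cast_nonneg n]
  · linarith

lemma DeleteMin.exists_outcome {α κ : Type*} [LinearOrder κ] {F G : Forest α κ} {t N : ℕ}
    (h : DeleteMin F G t) (hF : F.items.Nodup) (T fl' : α → Bool)
    (hT : ∀ x ∈ F.items, x ∉ G.items → T x = true) (hN : t ≤ N) :
    G.items.countP T + 1 = F.items.countP T ∧
    ∃ fl : α → Bool, (∀ x, x ∉ F.items → fl x = fl' x) ∧ ∀ A, RepresentsRoots T fl F A →
      ∃ B, RepresentsRoots T fl' G B ∧ rootEnergy N B + t ≤ rootEnergy N A +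
        10 ^ 20 * (1 + Real.log (F.items.countP T)) := by
  classical
  cases h with
  | mk e k c G t h =>
    have hperm := h.items_perm
    simp only [items, List.append_nil, List.nodup_cons, List.mem_cons] at hF hT ⊢
    have hTe := hT e (Or.inl rfl) fun hx => hF.1 (hperm.mem_iff.1 hx)
    refine ⟨by rw [hperm.countP_eq T, List.countP_cons, if_pos hTe],
      -- Exactly the children of the removed root are cut by this deletion, so their links were
      -- planned.
      fun x => if x ∈ c.rootItems then true else fl' x,
      fun x hx => ?_, fun A hA => ?_⟩
    · refine if_neg fun hx' => hx (Or.inr ?_)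
      exact (items_perm_rootItems_append c).mem_iff.2 (List.mem_append_left _ hx')
    · obtain ⟨C, hC, hen⟩ := hA.exists_tree
      rw [hTe] at hC
      have hdisj := (items_perm_rootItems_append c).nodup_iff.1 hF.2
      obtain ⟨hall, hprom⟩ := RepresentsRoots.promote (fl' := fl') (fun x hx => if_pos hx)
        (fun x hx => if_neg fun hx' => (List.disjoint_of_nodup_append hdisj) hx' hx) hC
      obtain ⟨B, hB, ht, hen'⟩ := h.exists_outcome T fl' 3 0 C.promote le_rfl
        (by omega : 0 + t ≤ N) hprom
      refine ⟨B, hB, ?_⟩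
      have h1 := rootEnergy_promote_le N 0 C hall
      have hsz : size C ≤ (e :: items c).countP T :=
        hC.size_le.trans (by rw [List.countP_cons]; omega)
      have h2 := lowBound_le hsz
      have h3 := log_cast_mono hsz
      have h4 := log_cast_nonneg ((e :: items c).countP T)
      rw [rootSize_promote hall, length_promote] at hen'
      rw [length_promote] at ht
      rw [hen, hTe]
      -- Up to rounding, the third pass links one eighth of the children. The gain of 80/8 = 10 per
      -- child exceeds the 4 steps and the error 21/25.
      have h5 : (length C : ℝ) ≤ 8 * ((((length C + 1) / 2 + 1) / 2 / 2 : ℕ) : ℝ) + 4 := by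
        exact_mod_cast (by omega : length C ≤ 8 * (((length C + 1) / 2 + 1) / 2 / 2) + 4)
      have h6 : (t : ℝ) ≤ 4 * length C + 1 := by exact_mod_cast ht
      have h7 : ((length C - 1 : ℕ) : ℝ) ≤ length C := by exact_mod_cast Nat.sub_le _ _
      have h8 : (0 : ℝ) ≤ length C := by positivity
      simp only [passGain, length_promote, passWeight_zero, treeEnergy, if_true, gauge_zero] at hen' h1 ⊢
      push_cast
      linarith

/-! ### The time bounds -/

lemma log_le_lg {x : ℝ} (hx : 1 ≤ x) : Real.log x ≤ lg x := by
  refine le_trans ?_ (le_max_left _ _)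
  have h1 := Real.log_nonneg hx
  have h2 := Real.log_two_lt_d9
  rw [Real.logb, le_div_iff₀ (Real.log_pos (by norm_num))]
  nlinarith

lemma three_le_lg {n : ℕ} (hn : 8 ≤ n) : 3 ≤ lg n := by
  refine le_trans ?_ (le_max_left _ _)
  have h : (8 : ℝ) ≤ n := by exact_mod_cast hn
  rw [Real.le_logb_iff_rpow_le (by norm_num) (by linarith)]
  norm_num
  linarith

lemma three_halves_le_lg {x : ℝ} (hx : 3 ≤ x) : 3 / 2 ≤ lg x := by
  refine le_trans ?_ (le_max_left _ _)
  have h2 : Real.log ((2 : ℝ) ^ 3) ≤ Real.log (x ^ 2) :=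
    Real.log_le_log (by norm_num) (by nlinarith)
  rw [Real.log_pow, Real.log_pow] at h2
  rw [Real.logb, le_div_iff₀ (Real.log_pos (by norm_num))]
  push_cast at h2
  linarith

lemma half_le_lg {x : ℝ} (hx : 3 / 2 ≤ x) : 1 / 2 ≤ lg x := by
  refine le_trans ?_ (le_max_left _ _)
  have h2 : Real.log (2 : ℝ) ≤ Real.log (x ^ 2) :=
    Real.log_le_log (by norm_num) (by nlinarith)
  rw [Real.log_pow] at h2
  rw [Real.logb, le_div_iff₀ (Real.log_pos (by norm_num))]
  push_cast at h2
  linarith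

/-- Ramp i vanishes at x once (3/2)^i ≥ 1 + 4000·x. Since log(3/2) ≥ 2/5, at most ⌈5/2·log(1 +
4000·x)⌉ ramps remain, each at most x. -/
lemma gauge_zero_left_le (N : ℕ) {x : ℝ} (hx : 0 ≤ x) :
    gauge N 0 x ≤ (5 / 2 * Real.log (1 + 4000 * x) + 1) * x := by
  set M := ⌈5 / 2 * Real.log (1 + 4000 * x)⌉₊ with hM
  have hlog : 0 ≤ Real.log (1 + 4000 * x) := Real.log_nonneg (by linarith)
  have hterm : ∀ i, max (x - threshold i) 0 ≤ if i < M then x else 0 := by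
    intro i
    split_ifs with h
    · exact max_le (by linarith [threshold_nonneg i]) hx
    · refine max_le ?_ le_rfl
      have h1 : 5 / 2 * Real.log (1 + 4000 * x) ≤ i := Nat.ceil_le.1 (not_lt.1 h)
      have h2 : Real.log (1 + 4000 * x) ≤ Real.log (passWeight i) := by
        rw [passWeight, Real.log_pow]
        nlinarith [two_fifths_le_log, (Nat.cast_nonneg i : (0 : ℝ) ≤ i)]
      have h3 := (Real.log_le_log_iff (by linarith) (passWeight_pos i)).1 h2
      unfold threshold
      linarith
  have hsum : gauge N 0 x ≤ ∑ i ∈ Finset.range M, x := by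
    unfold gauge
    refine (Finset.sum_le_sum fun i _ => hterm i).trans ?_
    rw [← Finset.sum_filter]
    refine Finset.sum_le_sum_of_subset_of_nonneg ?_ fun _ _ _ => hx
    intro i hi
    exact Finset.mem_range.2 (Finset.mem_filter.1 hi).2
  rw [Finset.sum_const, Finset.card_range, nsmul_eq_mul] at hsum
  refine hsum.trans (mul_le_mul_of_nonneg_right ?_ hx)
  exact (Nat.ceil_lt_add_one (by positivity)).le

lemma decreaseKey_cost_le (N n : ℕ) :
    405 + 7200 * gauge N 0 (logLevel (Real.log n)) ≤
      10 ^ 6 * (lg (lg (max n 8 : ℕ)) * lg (lg (lg (max n 8 : ℕ)))) := by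
  have h3 := three_le_lg (le_max_right n 8)
  have hlog : Real.log n ≤ lg (max n 8 : ℕ) :=
    (log_cast_mono (le_max_left n 8)).trans
      (log_le_lg (by exact_mod_cast (by omega : 1 ≤ max n 8)))
  set u := lg (max n 8 : ℕ)
  have hy := three_halves_le_lg h3
  have hxy : logLevel (Real.log n) ≤ lg u := by
    refine (Real.log_le_log (lt_of_lt_of_le one_pos (le_max_left _ _)) ?_).trans
      (log_le_lg (by linarith : 1 ≤ u))
    exact max_le (by linarith) (by linarith)
  set y := lg u
  have hz := half_le_lg hy
  have hlz := log_le_lg (by linarith : 1 ≤ y)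
  set z := lg y
  have h4 : Real.log (1 + 4000 * y) ≤ 12 + z := by
    have e1 : Real.log (1 + 4000 * y) ≤ Real.log (2 ^ 12 * y) :=
      Real.log_le_log (by linarith) (by linarith)
    rw [Real.log_mul (by norm_num) (by linarith), Real.log_pow] at e1
    have := Real.log_two_lt_d9
    push_cast at e1
    linarith
  have h5 := gauge_mono N 0 hxy
  have h6 := gauge_zero_left_le N (show 0 ≤ y by linarith)
  have h7 : (5 / 2 * Real.log (1 + 4000 * y) + 1) * y ≤ 65 * z * y :=
    mul_le_mul_of_nonneg_right (by linarith) (by linarith)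
  have h8 : 1 ≤ 2 * (y * z) := by nlinarith
  nlinarith

lemma log_le_lg_max (n : ℕ) : Real.log n ≤ lg (max n 8 : ℕ) ∧ 3 ≤ lg (max n 8 : ℕ) :=
  ⟨(log_cast_mono (le_max_left n 8)).trans
      (log_le_lg (by exact_mod_cast (by omega : 1 ≤ max n 8))), three_le_lg (le_max_right n 8)⟩

/-! ### The potential of a single heap -/

/-- The energy of a heap with root list `F`, decreased by a function of the number of its temporary
items. -/
noncomputable def heapPotential {α κ : Type*} (N : ℕ) (T : α → Bool) (F : Forest α κ)
    (A : MForest) : ℝ :=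
  rootEnergy N A - 172800000 * Real.log ((F.items.countP T).factorial : ℕ)

lemma factorial_mul_factorial_le {a b : ℕ} (ha : 0 < a) (hb : 0 < b) :
    a.factorial * b.factorial ≤ (a + b - 1).factorial := by
  induction a, ha using Nat.le_induction with
  | base => simp
  | succ a ha ih =>
    have e : a + 1 + b - 1 = (a + b - 1) + 1 := by omega
    rw [e, Nat.factorial_succ, Nat.factorial_succ, mul_assoc]
    exact Nat.mul_le_mul (by omega) ih

lemma log_factorial_add_le (a b : ℕ) :
    Real.log (a.factorial : ℕ) + Real.log (b.factorial : ℕ) ≤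
      Real.log ((a + b).factorial : ℕ) := by
  rw [← Real.log_mul (by positivity) (by positivity)]
  exact_mod_cast log_cast_mono (Nat.le_of_dvd (Nat.factorial_pos _)
    (Nat.factorial_mul_factorial_dvd_factorial_add a b))

/-- The binomial coefficient of a + b over a is at least a + b for positive a and b. Its logarithm
pays for the link of two temporary roots in `Join.exists_outcome`. -/
lemma log_factorial_add_add_log_le {a b : ℕ} (ha : 0 < a) (hb : 0 < b) :
    Real.log (a.factorial : ℕ) + Real.log (b.factorial : ℕ) + Real.log ((a + b : ℕ) : ℝ) ≤
      Real.log ((a + b).factorial : ℕ) := by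
  have h : (0 : ℝ) < ((a + b : ℕ) : ℝ) := by exact_mod_cast (by omega : 0 < a + b)
  rw [← Real.log_mul (by positivity) (by positivity), ← Real.log_mul (by positivity) h.ne']
  have e : (a + b).factorial = (a + b - 1).factorial * (a + b) := by
    conv_lhs => rw [show a + b = (a + b - 1) + 1 by omega, Nat.factorial_succ]
    rw [mul_comm, show a + b - 1 + 1 = a + b by omega]
  rw [e]
  exact_mod_cast log_cast_mono (Nat.mul_le_mul_right (a + b) (factorial_mul_factorial_le ha hb))

lemma log_factorial_succ (n : ℕ) :
    Real.log ((n + 1).factorial : ℕ) =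
      Real.log ((n + 1 : ℕ) : ℝ) + Real.log (n.factorial : ℕ) := by
  rw [Nat.factorial_succ, Nat.cast_mul, Real.log_mul (by positivity) (by positivity)]

lemma Join.exists_outcome {α κ : Type*} [LinearOrder κ] {F G W : Forest α κ} {t : ℕ}
    (h : Join F G W t) {T fl : α → Bool} {A B : MForest} (hA : RepresentsRoots T fl F A)
    (hB : RepresentsRoots T fl G B) (N : ℕ) :
    ∃ D, RepresentsRoots T fl W D ∧ heapPotential N T W D + t ≤
      heapPotential N T F A + heapPotential N T G B + 172800002 := by
  have hnil : ∀ {A}, RepresentsRoots T fl (nil : Forest α κ) A →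
      heapPotential N T (nil : Forest α κ) A = 0 := by
    intro A h
    obtain rfl := h.eq_nil
    simp [heapPotential, rootEnergy, items]
  cases h with
  | nil_left => exact ⟨B, hB, by rw [hnil hA]; norm_num⟩
  | nil_right => exact ⟨A, hA, by rw [hnil hB]; norm_num⟩
  | link _ _ _ h =>
    have hp := h.items_perm.countP_eq T
    rw [List.countP_append] at hp
    obtain ⟨e, k, c, f, l, d, rfl, rfl⟩ : ∃ e k c f l d, F = tree e k c ∧ G = tree f l d := by
      cases h
      · exact ⟨_, _, _, _, _, _, rfl, rfl⟩
      · exact ⟨_, _, _, _, _, _, rfl, rfl⟩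
    obtain ⟨C, hC, henC⟩ := hA.exists_tree
    obtain ⟨E, hE, henE⟩ := hB.exists_tree
    obtain ⟨D, hD, henD⟩ := h.exists_outcome hC hE N
    refine ⟨D, hD, ?_⟩
    simp only [heapPotential, henC, henE]
    rw [hp] at henD ⊢
    have h1 := log_factorial_add_le ((tree e k c).items.countP T) ((tree f l d).items.countP T)
    push_cast
    by_cases hr : (T e && T f) = true
    · rw [if_pos hr] at henD
      have hr' := Bool.and_eq_true_iff.1 hr
      have ha : 0 < (tree e k c).items.countP T := List.countP_pos_iff.2 ⟨e, by simp [items], hr'.1⟩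
      have hb : 0 < (tree f l d).items.countP T := List.countP_pos_iff.2 ⟨f, by simp [items], hr'.2⟩
      have h2 := log_factorial_add_add_log_le ha hb
      have h3 := gauge_logLevel_log_le N
        ((tree e k c).items.countP T + (tree f l d).items.countP T)
      linarith
    · rw [if_neg hr] at henD
      linarith

/-! ### The potential of a collection of heaps -/

/-- The marked forests `A` describe the heaps `F`. -/
def RepresentsAll {α κ : Type*} (T fl : α → Bool) (F : ℕ → Forest α κ) (A : ℕ → MForest) : Prop :=
  ∀ h, RepresentsRoots T fl (F h) (A h)

/-- The potential of the heaps with names smaller than `B`. -/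
noncomputable def potential {α κ : Type*} (N B : ℕ) (T : α → Bool) (F : ℕ → Forest α κ)
    (A : ℕ → MForest) : ℝ :=
  ∑ h ∈ Finset.range B, heapPotential N T (F h) (A h)

/-- No item occurs twice in a collection of heaps. -/
def ItemsDistinct {α κ : Type*} (F : ℕ → Forest α κ) : Prop :=
  (∀ h, (F h).items.Nodup) ∧ ∀ h h' x, x ∈ (F h).items → x ∈ (F h').items → h = h'

lemma ItemsDistinct.update {α κ : Type*} {F : ℕ → Forest α κ} (hF : ItemsDistinct F) (h : ℕ)
    {G : Forest α κ} (hG : G.items.Nodup)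
    (hGF : ∀ x ∈ G.items, ∀ h', x ∈ (F h').items → h' = h) :
    ItemsDistinct (Function.update F h G) := by
  refine ⟨fun h' => ?_, fun h₁ h₂ x h1 h2 => ?_⟩
  · rcases eq_or_ne h' h with rfl | hne
    · rwa [Function.update_self]
    · rw [Function.update_of_ne hne]
      exact hF.1 h'
  · by_cases e1 : h₁ = h <;> by_cases e2 : h₂ = h
    · rw [e1, e2]
    · rw [e1, Function.update_self] at h1
      rw [Function.update_of_ne e2] at h2
      exact e1.trans (hGF x h1 _ h2).symm
    · rw [e2, Function.update_self] at h2
      rw [Function.update_of_ne e1] at h1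
      exact (hGF x h2 _ h1).trans e2.symm
    · rw [Function.update_of_ne e1] at h1
      rw [Function.update_of_ne e2] at h2
      exact hF.2 _ _ x h1 h2

lemma ItemsDistinct.update_of_subset {α κ : Type*} {F : ℕ → Forest α κ} (hF : ItemsDistinct F)
    (h : ℕ) {G : Forest α κ} (hG : G.items.Nodup) (hGF : ∀ x ∈ G.items, x ∈ (F h).items) :
    ItemsDistinct (Function.update F h G) :=
  hF.update h hG fun x hx _ hx' => hF.2 _ _ x hx' (hGF x hx)

lemma heapPotential_congr {α κ : Type*} (N : ℕ) {T T' : α → Bool} {F : Forest α κ} (A : MForest)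
    (h : ∀ x ∈ F.items, T x = T' x) : heapPotential N T F A = heapPotential N T' F A := by
  have : F.items.countP T = F.items.countP T' :=
    List.countP_congr fun x hx => by rw [h x hx]
  rw [heapPotential, heapPotential, this]

lemma RepresentsAll.update {α κ : Type*} {T T' fl fl' : α → Bool} {F : ℕ → Forest α κ}
    {A : ℕ → MForest} (hA : RepresentsAll T fl F A) {h : ℕ} {G : Forest α κ} {D : MForest}
    (hD : RepresentsRoots T' fl' G D)
    (hcongr : ∀ h' ≠ h, ∀ x ∈ (F h').items, T x = T' x ∧ fl x = fl' x) {B : ℕ} (hB : h < B)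
    (N : ℕ) :
    RepresentsAll T' fl' (Function.update F h G) (Function.update A h D) ∧
      potential N B T' (Function.update F h G) (Function.update A h D) =
        potential N B T F A + (heapPotential N T' G D - heapPotential N T (F h) (A h)) := by
  constructor
  · intro h'
    rcases eq_or_ne h' h with rfl | hne
    · simpa using hD
    · rw [Function.update_of_ne hne, Function.update_of_ne hne]
      exact (hA h').congr (hcongr h' hne)
  · unfold potential
    rw [← Finset.add_sum_erase _ _ (Finset.mem_range.2 hB),
      ← Finset.add_sum_erase (Finset.range B) (fun h' => heapPotential N T (F h') (A h'))
        (Finset.mem_range.2 hB), Function.update_self, Function.update_self]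
    have : ∑ h' ∈ (Finset.range B).erase h,
        heapPotential N T' (Function.update F h G h') (Function.update A h D h') =
        ∑ h' ∈ (Finset.range B).erase h, heapPotential N T (F h') (A h') := by
      refine Finset.sum_congr rfl fun h' hh' => ?_
      have hne := Finset.ne_of_mem_erase hh'
      rw [Function.update_of_ne hne, Function.update_of_ne hne]
      exact (heapPotential_congr N _ fun x hx => (hcongr h' hne x hx).1).symm
    rw [this]
    ring

/-- The amortized cost of an operation on a single heap. -/
lemma exists_outcome_update {α κ : Type*} {T T' fl' : α → Bool} {F : ℕ → Forest α κ}
    (hF : ItemsDistinct F) {h B N : ℕ} {G : Forest α κ} {t X : ℝ} (hB : h < B)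
    (hT : ∀ h', ∀ x ∈ (Function.update F h G h').items, T x = T' x)
    (hloc : ∃ fl : α → Bool, (∀ x, x ∉ (F h).items → fl x = fl' x) ∧
      ∀ A, RepresentsRoots T fl (F h) A → ∃ D, RepresentsRoots T fl' G D ∧
        heapPotential N T G D + t ≤ heapPotential N T (F h) A + X) :
    ∃ fl : α → Bool, ∀ A, RepresentsAll T fl F A →
      ∃ A', RepresentsAll T' fl' (Function.update F h G) A' ∧
        potential N B T' (Function.update F h G) A' + t ≤ potential N B T F A + X := by
  obtain ⟨fl, hfl, hout⟩ := hloc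
  refine ⟨fl, fun A hA => ?_⟩
  obtain ⟨D, hD, hen⟩ := hout _ (hA h)
  have hG : ∀ x ∈ G.items, T x = T' x := fun x hx => hT h x (by rwa [Function.update_self])
  obtain ⟨h1, h2⟩ := hA.update (hD.congr fun x hx => ⟨hG x hx, rfl⟩) (h := h) (fun h' hne x hx =>
    ⟨hT h' x (by rwa [Function.update_of_ne hne]),
      hfl x fun hx' => hne (hF.2 _ _ x hx hx')⟩) hB N
  refine ⟨_, h1, ?_⟩
  rw [h2, ← heapPotential_congr N D hG]
  linarith

/-! ### One operation -/

/-- The contents of the heaps in a collection, where missing heaps are considered empty. -/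
def contents {α K : Type*} (σ : State α K) (h : ℕ) : Forest α (WithBot K) := (σ h).getD nil

lemma contents_eq {α K : Type*} {σ : State α K} {h : ℕ} {F : Forest α (WithBot K)}
    (hF : σ h = some F) : contents σ h = F := by
  simp [contents, hF]

lemma contents_update {α K : Type*} (σ : State α K) (h : ℕ) (o : Option (Forest α (WithBot K))) :
    contents (Function.update σ h o) = Function.update (contents σ) h (o.getD nil) := by
  funext h'
  rcases eq_or_ne h' h with rfl | hne
  · simp [contents]
  · simp [contents, Function.update_of_ne hne]

lemma present_iff {α K : Type*} {σ : State α K} {e : α} :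
    Present σ e ↔ ∃ h, e ∈ (contents σ h).items := by
  constructor
  · rintro ⟨h, F, hF, he⟩
    exact ⟨h, by rwa [contents_eq hF]⟩
  · rintro ⟨h, he⟩
    cases hF : σ h with
    | none => simp [contents, hF, items] at he
    | some F => exact ⟨h, F, hF, by rwa [contents_eq hF] at he⟩

/-- A number larger than the names of the heaps that the operation changes. -/
def Op.nameBound {α K : Type*} : Op α K → ℕ
  | .makeHeap h => h + 1
  | .findMin h _ => h + 1
  | .insert h _ _ => h + 1
  | .meld h₁ h₂ => h₁ + h₂ + 1
  | .decreaseKey h _ _ => h + 1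
  | .deleteMin h => h + 1
  | .delete h _ => h + 1

lemma Step.itemsDistinct {α K : Type*} [LinearOrder K] {σ σ' : State α K} {o : Op α K} {t : ℕ}
    (hs : Step σ o σ' t) (hσ : ItemsDistinct (contents σ)) : ItemsDistinct (contents σ') := by
  have hdel : ∀ {F G : Forest α (WithBot K)} {t : ℕ}, F.items.Nodup → DeleteMin F G t →
      G.items.Nodup ∧ ∀ x ∈ G.items, x ∈ F.items := by
    intro F G t hF h
    cases h with
    | mk e k c G t h =>
      have hp := h.items_perm
      simp only [items, List.append_nil, List.nodup_cons] at hF ⊢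
      exact ⟨hp.nodup_iff.2 hF.2, fun x hx => List.mem_cons_of_mem _ (hp.mem_iff.1 hx)⟩
  cases hs with
  | makeHeap h hh =>
    rw [contents_update]
    exact hσ.update_of_subset h List.nodup_nil (by simp [items])
  | findMin h F hF => exact hσ
  | insert h e k F G t hF he hG =>
    have hp := hG.items_perm
    simp only [items, List.append_nil, List.cons_append, List.nil_append] at hp
    have he' := fun h' => not_exists.1 (mt present_iff.2 he) h'
    rw [contents_update]
    have hFd := contents_eq hF ▸ hσ.1 h
    refine hσ.update h (hp.nodup_iff.2 (List.nodup_cons.2 ⟨?_, hFd⟩)) fun x hx h' hx' => ?_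
    · rw [← contents_eq hF]
      exact he' h
    · rcases List.mem_cons.1 (hp.mem_iff.1 hx) with rfl | hx
      · exact absurd hx' (he' h')
      · exact hσ.2 _ _ x hx' (by rwa [contents_eq hF])
  | meld h₁ h₂ F₁ F₂ G t hne hF₁ hF₂ hG =>
    have hp := hG.items_perm
    rw [contents_update, contents_update]
    refine (hσ.update_of_subset h₂ (G := nil) List.nodup_nil (by simp [items])).update h₁ ?_ ?_
    · refine hp.nodup_iff.2 (List.Nodup.append (contents_eq hF₁ ▸ hσ.1 h₁)
        (contents_eq hF₂ ▸ hσ.1 h₂) fun x h1 h2 => hne (hσ.2 _ _ x ?_ ?_))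
      · rwa [contents_eq hF₁]
      · rwa [contents_eq hF₂]
    · intro x hx h' hx'
      rcases eq_or_ne h' h₂ with rfl | hne'
      · simp [items] at hx'
      · rw [Function.update_of_ne hne'] at hx'
        rcases List.mem_append.1 (hp.mem_iff.1 hx) with hx | hx
        · exact hσ.2 _ _ x hx' (by rwa [contents_eq hF₁])
        · exact absurd (hσ.2 _ _ x hx' (by rwa [contents_eq hF₂])) hne'
  | decreaseKey h e k F G t hF hG =>
    have hp := hG.items_perm
    rw [contents_update]
    refine hσ.update_of_subset h (hp.nodup_iff.2 (contents_eq hF ▸ hσ.1 h)) fun x hx => ?_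
    rw [contents_eq hF]
    exact hp.mem_iff.1 hx
  | deleteMin h F G t hF hG =>
    rw [contents_update]
    obtain ⟨h1, h2⟩ := hdel (contents_eq hF ▸ hσ.1 h) hG
    refine hσ.update_of_subset h h1 fun x hx => ?_
    rw [contents_eq hF]
    exact h2 x hx
  | delete h e F F' G s t hF hF' hG =>
    have hp := hF'.items_perm
    rw [contents_update]
    obtain ⟨h1, h2⟩ := hdel (hp.nodup_iff.2 (contents_eq hF ▸ hσ.1 h)) hG
    refine hσ.update_of_subset h h1 fun x hx => ?_
    rw [contents_eq hF]
    exact hp.mem_iff.1 (h2 x hx)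

/-- The prediction before the operation depends on the one after it, while the marks after it depend
on those before. Hence `fl` is chosen before the marked forests are quantified. -/
lemma Step.exists_outcome {α K : Type*} [LinearOrder K] {σ σ' : State α K} {o : Op α K} {t : ℕ}
    (hs : Step σ o σ' t) (hσ : ItemsDistinct (contents σ)) {T T' : α → Bool}
    (hT : ∀ x, Present σ' x → T x = T' x) (hT' : ∀ x, Present σ x → ¬ Present σ' x → T x = true)
    {N B : ℕ} (hN : t ≤ N) (hB : o.nameBound ≤ B) (fl' : α → Bool) :
    ∃ fl : α → Bool, ∀ A, RepresentsAll T fl (contents σ) A →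
      ∃ A', RepresentsAll T' fl' (contents σ') A' ∧
        potential N B T' (contents σ') A' + t ≤ potential N B T (contents σ) A +
          10 ^ 21 * amortizedBound (fun h => (contents σ h).items.countP T) o := by
  have hT1 : ∀ h, ∀ x ∈ (contents σ' h).items, T x = T' x :=
    fun h x hx => hT x (present_iff.2 ⟨h, hx⟩)
  have hsame : ∀ h, h < B → contents σ' = contents σ →
      ∃ fl : α → Bool, ∀ A, RepresentsAll T fl (contents σ) A →
      ∃ A', RepresentsAll T' fl' (contents σ') A' ∧
        potential N B T' (contents σ') A' + (1 : ℕ) ≤ potential N B T (contents σ) A +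
          10 ^ 21 * 1 := by
    intro h hB he
    have hup : contents σ' = Function.update (contents σ) h (contents σ h) := by
      rw [Function.update_eq_self, he]
    rw [hup] at hT1 ⊢
    exact exists_outcome_update hσ hB hT1 ⟨fl', fun _ _ => rfl, fun A hA => ⟨A, hA, by
      push_cast
      linarith⟩⟩
  have hgone : ∀ {h : ℕ} {F G : Forest α (WithBot K)}, σ h = some F →
      σ' = Function.update σ h (some G) → ∀ x ∈ F.items, x ∉ G.items → T x = true := by
    intro h F G hF he x hx hx'
    rw [← contents_eq hF] at hx
    refine hT' x (present_iff.2 ⟨h, hx⟩) fun hp => ?_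
    obtain ⟨h', hh'⟩ := present_iff.1 hp
    rw [he, contents_update] at hh'
    rcases eq_or_ne h' h with rfl | hne
    · rw [Function.update_self] at hh'
      exact hx' hh'
    · rw [Function.update_of_ne hne] at hh'
      exact hne (hσ.2 _ _ x hh' hx)
  cases hs with
  | makeHeap h hh =>
    refine hsame h hB ?_
    rw [contents_update]
    refine Function.update_eq_self_iff.2 ?_
    simp [contents, hh]
  | findMin h F hF => exact hsame h hB rfl
  | insert h e k F G t hF he hG =>
    rw [contents_update] at hT1 ⊢
    refine exists_outcome_update hσ hB hT1 ⟨fl', fun _ _ => rfl, fun A hA => ?_⟩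
    rw [contents_eq hF] at hA ⊢
    obtain ⟨A₁, hA₁, hen⟩ := Represents.exists_tree (T := T) (fl := fl') (e := e)
      (c := (nil : Forest α (WithBot K))) (C := .nil) trivial k
    obtain ⟨D, hD, henD⟩ := hG.exists_outcome hA₁ hA N
    refine ⟨D, hD, ?_⟩
    have h1 : heapPotential N T (tree e (k : WithBot K) nil) A₁ ≤ 400 := by
      rw [heapPotential, hen]
      have h2 : 0 ≤ Real.log (((tree e (k : WithBot K) nil).items.countP T).factorial : ℕ) :=
        log_cast_nonneg _
      have h3 : (if T e = true then 200 else 0 : ℝ) ≤ 200 := by split_ifs <;> norm_num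
      simp only [treeEnergy, variation, energy]
      linarith
    simp only [amortizedBound, Option.getD_some]
    push_cast
    linarith
  | meld h₁ h₂ F₁ F₂ G t hne hF₁ hF₂ hG =>
    rw [contents_update, contents_update] at hT1 ⊢
    simp only [Op.nameBound] at hB
    have hp := hG.items_perm
    have hG1 : ∀ x ∈ G.items, T x = T' x := fun x hx => hT1 h₁ x (by simpa using hx)
    refine ⟨fl', fun A hA => ?_⟩
    have hA₁ := hA h₁
    have hA₂ := hA h₂
    rw [contents_eq hF₁] at hA₁
    rw [contents_eq hF₂] at hA₂
    obtain ⟨D, hD, hen⟩ := hG.exists_outcome hA₁ hA₂ N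
    obtain ⟨a1, a2⟩ := hA.update (h := h₂) (G := nil) (D := .nil) (T' := T) (fl' := fl') trivial
      (fun _ _ _ _ => ⟨rfl, rfl⟩) (by omega : h₂ < B) N
    obtain ⟨b1, b2⟩ := a1.update (h := h₁) (hD.congr fun x hx => ⟨hG1 x hx, rfl⟩)
      (fun h' hne' x hx => ⟨hT1 h' x (by rwa [Option.getD_some, Function.update_of_ne hne']), rfl⟩)
      (by omega : h₁ < B) N
    refine ⟨_, b1, ?_⟩
    have hnil : heapPotential N T (nil : Forest α (WithBot K)) .nil = 0 := by
      simp [heapPotential, rootEnergy, items]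
    rw [Option.getD_some, Option.getD_none, b2, a2, ← heapPotential_congr N D hG1,
      Function.update_of_ne hne, Function.update_of_ne hne, contents_eq hF₁, contents_eq hF₂, hnil]
    simp only [amortizedBound]
    push_cast
    linarith
  | decreaseKey h e k F G t hF hG =>
    rw [contents_update] at hT1 ⊢
    refine exists_outcome_update hσ hB hT1 ?_
    have hp := hG.items_perm.countP_eq T
    have hnd := hσ.1 h
    simp only [amortizedBound]
    rw [contents_eq hF] at hnd ⊢
    obtain ⟨fl, hfl, hout⟩ := hG.exists_outcome hnd T fl' N
    refine ⟨fl, hfl, fun A hA => ?_⟩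
    obtain ⟨D, hD, hen⟩ := hout A hA
    refine ⟨D, hD, ?_⟩
    have h1 := decreaseKey_cost_le N (F.items.countP T)
    have h2 := gauge_nonneg N 0 (logLevel (Real.log (F.items.countP T)))
    simp only [heapPotential, Option.getD_some, hp]
    linarith
  | deleteMin h F G t hF hG =>
    have hgo := hgone hF rfl
    rw [contents_update] at hT1 ⊢
    refine exists_outcome_update hσ hB hT1 ?_
    have hnd := hσ.1 h
    simp only [amortizedBound]
    rw [contents_eq hF] at hnd ⊢
    obtain ⟨hc, fl, hfl, hout⟩ := hG.exists_outcome hnd T fl' hgo hN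
    refine ⟨fl, hfl, fun A hA => ?_⟩
    obtain ⟨D, hD, hen⟩ := hout A hA
    refine ⟨D, hD, ?_⟩
    obtain ⟨h1, h2⟩ := log_le_lg_max (F.items.countP T)
    have h3 := log_factorial_succ (G.items.countP T)
    have h4 := log_cast_nonneg (F.items.countP T)
    rw [hc] at h3
    simp only [heapPotential, Option.getD_some]
    linarith
  | delete h e F F' G s t hF hF' hG =>
    have hgo := hgone hF rfl
    rw [contents_update] at hT1 ⊢
    refine exists_outcome_update hσ hB hT1 ?_
    have hnd := hσ.1 h
    simp only [amortizedBound]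
    rw [contents_eq hF] at hnd ⊢
    have hp := hF'.items_perm
    obtain ⟨hc, fl₁, hfl₁, hout₁⟩ := hG.exists_outcome (hp.nodup_iff.2 hnd) T fl'
      (fun x hx => hgo x (hp.mem_iff.1 hx)) (by omega : t ≤ N)
    obtain ⟨fl, hfl, hout⟩ := hF'.exists_outcome hnd T fl₁ N
    refine ⟨fl, fun x hx => (hfl x hx).trans (hfl₁ x fun hx' => hx (hp.mem_iff.1 hx')),
      fun A hA => ?_⟩
    obtain ⟨A₁, hA₁, hen₁⟩ := hout A hA
    obtain ⟨D, hD, hen⟩ := hout₁ A₁ hA₁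
    refine ⟨D, hD, ?_⟩
    rw [hp.countP_eq T] at hc hen
    obtain ⟨h1, h2⟩ := log_le_lg_max (F.items.countP T)
    have h3 := log_factorial_succ (G.items.countP T)
    have h4 := log_cast_nonneg (F.items.countP T)
    have h5 := gauge_logLevel_log_le N (F.items.countP T)
    rw [hc] at h3
    simp only [heapPotential, Option.getD_some, Nat.cast_add]
    linarith

lemma Step.time_le {α K : Type*} [LinearOrder K] {σ σ' : State α K} {o : Op α K} {t : ℕ}
    (hs : Step σ o σ' t) (ho : o.IsConstantTime) : t ≤ 3 := by
  cases hs with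
  | makeHeap => omega
  | findMin => omega
  | insert h e k F G t hF he hG => cases hG <;> omega
  | meld h₁ h₂ F₁ F₂ G t hne hF₁ hF₂ hG => cases hG <;> omega
  | decreaseKey => exact ho.elim
  | deleteMin => exact ho.elim
  | delete => exact ho.elim

/-! ### Sequences of operations -/

lemma energy_nonneg_of_represents {α κ : Type*} {T fl : α → Bool} (hT : ∀ x, T x = false)
    (N : ℕ) : ∀ {p : Bool} {F : Forest α κ} {A : MForest}, Represents T fl p F A → 0 ≤ energy N A
  | _, .nil, _, h => by
    obtain rfl := h.eq_nil
    exact le_rfl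
  | p, .cons e _ c r, _, h => by
    obtain ⟨x, c', r', rfl, h1, h2, h3, h4, h5⟩ := h.exists_cons
    have i1 := energy_nonneg_of_represents hT N h4
    have i2 := energy_nonneg_of_represents hT N h5
    have i3 := MForest.variation_nonneg N 0 c'
    have i4 : 0 ≤ (if x.planned = true then 200 else 0 : ℝ) := by split_ifs <;> norm_num
    rw [hT] at h1
    simp only [energy, h1, Bool.and_false, Bool.false_eq_true, if_false]
    linarith

lemma rootEnergy_nonneg_of_represents {α κ : Type*} {T fl : α → Bool} (hT : ∀ x, T x = false)
    (N : ℕ) : ∀ {F : Forest α κ} {A : MForest}, RepresentsRoots T fl F A → 0 ≤ rootEnergy N A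
  | .nil, _, h => by
    obtain rfl := h.eq_nil
    exact le_rfl
  | .cons e _ c r, _, h => by
    obtain ⟨x, c', r', rfl, h1, h2, h3, h4⟩ := h.exists_cons
    have i1 := energy_nonneg_of_represents hT N h3
    have i2 := rootEnergy_nonneg_of_represents hT N h4
    have i3 := MForest.variation_nonneg N 0 c'
    rw [hT] at h1
    simp only [rootEnergy, rootNodeEnergy, h1, Bool.false_eq_true, if_false]
    linarith

open Classical in
/-- The items that are deleted by the operation with index `i` or later. -/
noncomputable def deletedLater {α K : Type*} (m : ℕ) (σ : ℕ → State α K) (i : ℕ) (x : α) : Bool :=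
  decide (∃ j, i < j ∧ j ≤ m ∧ ¬ Present (σ j) x)

lemma numTemporary_eq {α K : Type*} (m : ℕ) (σ : ℕ → State α K) (i h : ℕ)
    (hd : (contents (σ i) h).items.Nodup) :
    numTemporary m σ i h = (contents (σ i) h).items.countP (deletedLater m σ i) := by
  classical
  have hset : {e : α | (∃ F, σ i h = some F ∧ e ∈ F.items) ∧
      ∃ j, i < j ∧ j ≤ m ∧ ¬ Present (σ j) e} =
      ((contents (σ i) h).items.filter (deletedLater m σ i)).toFinset := by
    ext e
    have : (∃ F, σ i h = some F ∧ e ∈ F.items) ↔ e ∈ (contents (σ i) h).items := by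
      cases hF : σ i h <;> simp [contents, hF, items]
    simp [this, deletedLater]
  rw [numTemporary, hset, Set.ncard_coe_finset, List.toFinset_card_of_nodup (hd.filter _),
    List.countP_eq_length_filter]

lemma IsExecution.itemsDistinct {α K : Type*} [LinearOrder K] {m : ℕ} {op : ℕ → Op α K}
    {σ : ℕ → State α K} {time : ℕ → ℕ} (hex : IsExecution m op σ time) :
    ∀ i ≤ m, ItemsDistinct (contents (σ i))
  | 0, _ => by
    rw [hex.start]
    exact ⟨fun _ => List.nodup_nil, by simp [contents, items]⟩
  | i + 1, hi => (hex.step i (by omega)).itemsDistinct (hex.itemsDistinct i (by omega))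

lemma IsExecution.sum_time_le_potential {α K : Type*} [LinearOrder K] {m : ℕ} {op : ℕ → Op α K}
    {σ : ℕ → State α K} {time : ℕ → ℕ} (hex : IsExecution m op σ time) {N B : ℕ}
    (hN : ∀ i < m, time i ≤ N) (hB : ∀ i < m, (op i).nameBound ≤ B) {i : ℕ} (hi : i ≤ m) :
    ∃ fl : α → Bool, ∀ A, RepresentsAll (deletedLater m σ i) fl (contents (σ i)) A →
      ∑ k ∈ Finset.Ico i m, (time k : ℝ) ≤
        potential N B (deletedLater m σ i) (contents (σ i)) A +
          10 ^ 21 * ∑ k ∈ Finset.Ico i m, amortizedBound (numTemporary m σ k) (op k) := by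
  induction hi using Nat.decreasingInduction with
  | self =>
    -- After the last operation nothing is temporary: the factorial term is log 0! = 0, and the
    -- negative base terms are absent.
    refine ⟨fun _ => false, fun A hA => ?_⟩
    have hT : ∀ x, deletedLater m σ m x = false := by
      intro x
      simp only [deletedLater, decide_eq_false_iff_not]
      rintro ⟨j, h1, h2, -⟩
      omega
    simp only [Finset.Ico_self, Finset.sum_empty, mul_zero, add_zero]
    refine Finset.sum_nonneg fun h _ => ?_
    have h1 := rootEnergy_nonneg_of_represents hT N (hA h)
    have h2 : (contents (σ m) h).items.countP (deletedLater m σ m) = 0 :=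
      List.countP_eq_zero.2 fun x _ => by simp [hT]
    simpa [heapPotential, h2] using h1
  | of_succ i hi ih =>
    obtain ⟨fl', hfl'⟩ := ih
    have hσ := hex.itemsDistinct i hi.le
    obtain ⟨fl, hfl⟩ := (hex.step i hi).exists_outcome hσ (T := deletedLater m σ i)
      (T' := deletedLater m σ (i + 1)) (N := N) (B := B) (fun x hx => by
        simp only [deletedLater, decide_eq_decide]
        constructor
        · rintro ⟨j, h1, h2, h3⟩
          refine ⟨j, lt_of_le_of_ne h1 ?_, h2, h3⟩
          rintro rfl
          exact h3 hx
        · rintro ⟨j, h1, h2, h3⟩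
          exact ⟨j, by omega, h2, h3⟩) (fun x _ hx => by
        simp only [deletedLater, decide_eq_true_eq]
        exact ⟨i + 1, by omega, hi, hx⟩) (hN i hi) (hB i hi) fl'
    refine ⟨fl, fun A hA => ?_⟩
    obtain ⟨A', hA', hen⟩ := hfl A hA
    have h1 := hfl' A' hA'
    have hnum : numTemporary m σ i =
        fun h => (contents (σ i) h).items.countP (deletedLater m σ i) :=
      funext fun h => numTemporary_eq m σ i h (hσ.1 h)
    rw [← hnum] at hen
    rw [Finset.sum_eq_sum_Ico_succ_bot hi, Finset.sum_eq_sum_Ico_succ_bot hi]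
    linarith

end MultipassHeap

theorem theoremT :
    ∃ C : ℝ, ∀ (α K : Type*) [LinearOrder K] (m : ℕ)
      (op : ℕ → MultipassHeap.Op α K) (σ : ℕ → MultipassHeap.State α K) (time : ℕ → ℕ),
      MultipassHeap.IsExecution m op σ time →
        (∑ i ∈ Finset.range m, (time i : ℝ) ≤
          C * ∑ i ∈ Finset.range m,
            MultipassHeap.amortizedBound (MultipassHeap.numTemporary m σ i) (op i)) ∧
        ∀ i < m, (op i).IsConstantTime → (time i : ℝ) ≤ C := by
  refine ⟨10 ^ 21, fun α K _ m op σ time hex => ⟨?_, fun i hi ho => ?_⟩⟩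
  -- The total time serves as N, since it bounds the time of each operation and thus all pass
  -- indices; B exceeds every heap name that the operations change.
  · obtain ⟨fl, hfl⟩ := hex.sum_time_le_potential
      (N := ∑ i ∈ Finset.range m, time i) (B := ∑ i ∈ Finset.range m, (op i).nameBound)
      (fun i hi => Finset.single_le_sum (f := time) (fun _ _ => Nat.zero_le _)
        (Finset.mem_range.2 hi))
      (fun i hi => Finset.single_le_sum (f := fun i => (op i).nameBound) (fun _ _ => Nat.zero_le _)
        (Finset.mem_range.2 hi)) (Nat.zero_le m)
    have h0 : ∀ h, MultipassHeap.contents (σ 0) h = .nil := fun h => by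
      simp [MultipassHeap.contents, hex.start]
    have h1 := hfl (fun _ => .nil) fun h => by rw [h0]; trivial
    rw [← Finset.range_eq_Ico] at h1
    simpa [MultipassHeap.potential, MultipassHeap.heapPotential, MultipassHeap.MForest.rootEnergy,
      h0, MultipassHeap.Forest.items] using h1
  · have h3 : (time i : ℝ) ≤ 3 := by exact_mod_cast (hex.step i hi).time_le ho
    exact h3.trans (by norm_num)
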